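/- **Theorem 3.4.** *Learning problem.* Let $f(w;z)$, $w\in\mathbb R^q$, be a sample-wise loss, differentiable in $w$ with $\nabla_w f$ jointly measurable, integrable over the global data law $\mathcal D$, and let $F(w)=\mathbb E_{z\sim\mathcal D}f(w;z)$. Let $K\ge 1$ devices, integers $N,\gamma\ge 1$ with $d_b=N/\gamma$ a positive integer, $\sigma\in\mathbb R_{\ge0}^q$ and $L\in\mathbb R_{\ge0}^q$ with $\|L\|_1>0$ be given, and put $\eta=1/\sqrt{\|L\|_1 d_b}$. *Scheme.* Start from a deterministic $w^{(0)}$. In round $n$ device $m$ draws a batch of size $d_b$, forms the mini-batch gradient $\tilde g_m^{(n)}=\frac1{d_b}\sum_\ell\nabla f(w^{(n)};z_\ell)$ and the votes $\bar g^{(n)}_{m,i}=\operatorname{sign}\tilde g^{(n)}_{m,i}$. Each pair $(i,\pm)$ owns its own time–frequency bin, and on it the server receives $$r_{i,\pm}^{(n)}=\sqrt{E_0}\sum_{m:\,\bar g_{m,i}^{(n)}=\pm1}\sqrt{P_m^{(n)}}\;h^{(n)}_{m,i,\pm}\,s^{(n)}_{m,i}+n^{(n)}_{i,\pm},$$ where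 $E_0>0$, $|s^{(n)}_{m,i}|=1$, $h\sim\mathcal{CN}(0,1)$ (Rayleigh fading), $n\sim\mathcal{CN}(0,\sigma_n^2)$ with $\sigma_n>0$, and all channel coefficients, noises, batches (over devices and rounds) and the symbol arrays $s^{(n)}$ (over rounds) are independent. With $e_i^\pm=|r_{i,\pm}^{(n)}|^2$ the update is $w^{(n+1)}_i=w^{(n)}_i-\eta\operatorname{sign}(e_i^+-e_i^-)$. The powers satisfy $P_m^{(0)}=1$ and $P_m^{(n)}=P_m^{(n-1)}+a_m^{(n)}$, or, in the causal variant, $P_m^{(n)}=P_m^{(n-1)}+a_m^{(n-1)}$, for $n\ge1$, where $$a_m^{(n)}=\Big|\frac1q\sum_{i=1}^q\big(\mathbb 1[\bar g_{m,i}^{(n)}=v_i^{(n)}]-\mathbb 1[\bar g_{m,i}^{(n)}\ne v_i^{(n)}]\big)\Big|,\qquad v_i^{(n)}=\operatorname{sign}\sum_{m}\bar g_{m,i}^{(n)}.$$ *Power level.* Given everything drawn before round $n$, the powers $(P_m^{(n)})_m$ are independent of the votes cast on any one coordinate in round $n$ (automatic in the causal variant), and the constant $\vartheta>0$ is a level with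 $\vartheta\le\mathbb E\big[\frac1K\sum_mP_m^{(n)}\big]$ for all $0\le n<N$ (for instance the average power, if that is the same in every round). *Assumptions.* (a) $F\ge F^*$. (b) $F$ is differentiable and $|F(w')-F(w)-\nabla F(w)^{\mathsf T}(w'-w)|\le\frac12\sum_iL_i(w_i'-w_i)^2$ for all $w,w'$. (c) At every fixed $w$, each mini-batch gradient is square integrable with $\mathbb E[\tilde g_{m,i}]=\partial_iF(w)$ and $\mathbb E[(\tilde g_{m,i}-\partial_iF(w))^2]\le\sigma_i^2/d_b$. (d) At every fixed $w$, each $\tilde g_{m,i}$ has a unimodal law, symmetric around its mean. *Conclusion.* With $g^{(n)}=\nabla F(w^{(n)})$, $\beta=E_0\vartheta/\sigma_n^2$ and $\tau=\big(1+\frac{2}{\beta K}\big)\frac1{\sqrt\gamma}$, every $\|g^{(n)}\|_1$, $0\le n<N$, is integrable and $$\mathbb E\Big[\frac1N\sum_{n=0}^{N-1}\|g^{(n)}\|_1\Big]\le\frac1{\sqrt N}\Big(\tau\sqrt{\|L\|_1}\,\big(F(w^{(0)})-F^*+\tfrac\gamma2\big)+\frac{2\sqrt2}{6}\sqrt\gamma\,\|\sigma\|_1\Big).$$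 -/

import Mathlib

open MeasureTheory ProbabilityTheory
open scoped NNReal

noncomputable section

namespace FSKMV

/-- The model space `ℝ^q` with its Euclidean structure. -/
abbrev Model (q : ℕ) : Type := EuclideanSpace ℝ (Fin q)

/-- The `ℓ₁` norm of a vector. -/
def l1 {q : ℕ} (x : Fin q → ℝ) : ℝ := ∑ i, |x i|

/-! ### Probability laws -/

/-- The circularly symmetric complex Gaussian law `CN(0, v)`: real and imaginary parts are
independent, centred, of variance `v / 2`.  Its modulus is Rayleigh distributed. -/
def complexGaussian (v : ℝ≥0) : Measure ℂ :=
  ((gaussianReal 0 (v / 2)).prod (gaussianReal 0 (v / 2))).map (fun p : ℝ × ℝ => ⟨p.1, p.2⟩)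

/-- Unimodality of a law on the line: for some mode `a` the distribution function is convex to
the left of `a` and concave to the right of `a`. -/
def IsUnimodal (ν : Measure ℝ) : Prop :=
  ∃ a : ℝ, ConvexOn ℝ (Set.Iio a) (fun x => cdf ν x) ∧
    ConcaveOn ℝ (Set.Ioi a) (fun x => cdf ν x)

/-- Symmetry of a law on the line around its mean. -/
def IsSymmetricAboutMean (ν : Measure ℝ) : Prop :=
  ν.map (fun x => 2 * (∫ y, y ∂ν) - x) = ν

/-! ### The scheme -/

/-- Which round supplies the agreement score that is added to a device's power: the round in
which the new power is used, or the round just completed. -/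
inductive PowerTiming
  | sameRound
  | previousRound

/-- Parameters of the scheme with `K` devices, `q` model parameters, batches of size `d` from a
sample space `Z`, and an OFDM grid of `A` subcarriers and `S` symbols. -/
structure Scheme (Z : Type*) (K q d A S : ℕ) where
  /-- sample-wise loss `f(w; z)` -/
  loss : Model q → Z → ℝ
  /-- the time-frequency bin carrying the votes `+1` (`true`) resp. `-1` (`false`) on
  coordinate `i`; distinct pairs use distinct bins -/
  slot : Fin q × Bool ↪ Fin A × Fin S
  /-- symbol energy `E₀` -/
  symbolEnergy : ℝ
  /-- learning rate `η` -/
  stepSize : ℝ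
  /-- initial model `w⁽⁰⁾` -/
  init : Model q
  /-- timing of the power update -/
  timing : PowerTiming

/-- The random inputs: in round `n`, the batch of each device, the channel coefficient of each
device on each bin, the receiver noise on each bin, and the randomization symbols. -/
structure Inputs (Ω Z : Type*) (K q d A S : ℕ) where
  batch : ℕ → Fin K → Ω → (Fin d → Z)
  fading : ℕ → Fin K → Fin A × Fin S → Ω → ℂ
  noise : ℕ → Fin A × Fin S → Ω → ℂ
  phase : ℕ → Ω → (Fin K → Fin q → ℂ)

section Algorithm

variable {Ω Z : Type*} {K q d A S : ℕ}

/-- Mini-batch stochastic gradient of one device at the model `w`. -/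
def batchGrad (sch : Scheme Z K q d A S) (w : Model q) (b : Fin d → Z) : Model q :=
  (1 / (d : ℝ)) • ∑ l, gradient (fun w' => sch.loss w' (b l)) w

/-- One-bit quantized stochastic gradients: the vote of device `m` on coordinate `i`. -/
def votes (sch : Scheme Z K q d A S) (w : Model q) (b : Fin K → Fin d → Z) :
    Fin K → Fin q → ℝ :=
  fun m i => Real.sign (batchGrad sch w (b m) i)

/-- Majority vote without transmission. -/
def idealMV (g : Fin K → Fin q → ℝ) (i : Fin q) : ℝ := Real.sign (∑ m, g m i)

/-- The agreement score `|q⁻¹ ∑ᵢ (𝟙[gₘᵢ = vᵢ] - 𝟙[gₘᵢ ≠ vᵢ])|` of device `m` with the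
transmission-free majority vote. -/
def agreement (g : Fin K → Fin q → ℝ) (m : Fin K) : ℝ :=
  |(1 / (q : ℝ)) * ∑ i, (if g m i = idealMV g i then (1 : ℝ) else -1)|

/-- The vote value signalled by a bin of a pair. -/
def voteValue (s : Bool) : ℝ := if s then 1 else -1

/-- Transmitted symbol of device `m` on the `s`-bin of coordinate `i`. -/
def txSymbol (E₀ : ℝ) (phase : Fin K → Fin q → ℂ) (g : Fin K → Fin q → ℝ)
    (m : Fin K) (i : Fin q) (s : Bool) : ℂ :=
  if g m i = voteValue s then (Real.sqrt E₀ : ℂ) * phase m i else 0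

/-- Superposed symbol received on the `s`-bin of coordinate `i`. -/
def rxSymbol (sch : Scheme Z K q d A S) (P : Fin K → ℝ) (g : Fin K → Fin q → ℝ)
    (h : Fin K → Fin A × Fin S → ℂ) (z : Fin A × Fin S → ℂ) (phase : Fin K → Fin q → ℂ)
    (i : Fin q) (s : Bool) : ℂ :=
  ∑ m, (Real.sqrt (P m) : ℂ) * h m (sch.slot (i, s)) *
      txSymbol sch.symbolEnergy phase g m i s
    + z (sch.slot (i, s))

/-- Non-coherent energy detection: the sign of the difference `Δᵢ = eᵢ⁺ - eᵢ⁻` of the two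
received energies. -/
def detect (sch : Scheme Z K q d A S) (P : Fin K → ℝ) (g : Fin K → Fin q → ℝ)
    (h : Fin K → Fin A × Fin S → ℂ) (z : Fin A × Fin S → ℂ) (phase : Fin K → Fin q → ℂ)
    (i : Fin q) : ℝ :=
  Real.sign (‖rxSymbol sch P g h z phase i true‖ ^ 2 - ‖rxSymbol sch P g h z phase i false‖ ^ 2)

/-- The global model and the transmit powers `(w⁽ⁿ⁾, P⁽ⁿ⁾)` along the run.  All powers start
at `1`. -/
def state (sch : Scheme Z K q d A S) (X : Inputs Ω Z K q d A S) (ω : Ω) :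
    ℕ → Model q × (Fin K → ℝ)
  | 0 => (sch.init, fun _ => 1)
  | n + 1 =>
    let w := (state sch X ω n).1
    let P := (state sch X ω n).2
    let g := votes sch w (fun m => X.batch n m ω)
    let v := detect sch P g (fun m b => X.fading n m b ω) (fun b => X.noise n b ω) (X.phase n ω)
    let w' : Model q := w - sch.stepSize • WithLp.toLp 2 v
    let score : Fin K → ℝ := match sch.timing with
      | .sameRound => agreement (votes sch w' (fun m => X.batch (n + 1) m ω))
      | .previousRound => agreement g
    (w', fun m => P m + score m)

/-- The global model `w⁽ⁿ⁾`. -/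
def model (sch : Scheme Z K q d A S) (X : Inputs Ω Z K q d A S) (n : ℕ) (ω : Ω) : Model q :=
  (state sch X ω n).1

/-- The transmit powers `P⁽ⁿ⁾` used in round `n`. -/
def power (sch : Scheme Z K q d A S) (X : Inputs Ω Z K q d A S) (n : ℕ) (ω : Ω) : Fin K → ℝ :=
  (state sch X ω n).2

/-- The votes that all devices cast on coordinate `i` in round `n`. -/
def coordVotes (sch : Scheme Z K q d A S) (X : Inputs Ω Z K q d A S) (n : ℕ) (i : Fin q)
    (ω : Ω) : Fin K → ℝ :=
  fun m => votes sch (model sch X n ω) (fun m' => X.batch n m' ω) m i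

/-- The global loss `F(w)`: the mean of the sample-wise loss over the global data law. -/
def globalLoss [MeasurableSpace Z] (sch : Scheme Z K q d A S) (D : Measure Z) (w : Model q) : ℝ :=
  ∫ z, sch.loss w z ∂D

/-- `‖g⁽ⁿ⁾‖₁`, the `ℓ₁` norm of the gradient of the global loss at the model of round `n`. -/
def gradL1 [MeasurableSpace Z] (sch : Scheme Z K q d A S) (X : Inputs Ω Z K q d A S)
    (D : Measure Z) (n : ℕ) (ω : Ω) : ℝ :=
  l1 (fun i => gradient (globalLoss sch D) (model sch X n ω) i)

end Algorithm

/-! ### The random inputs -/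

/-- Labels of the elementary sources of randomness. -/
inductive Source (K A S : ℕ)
  | batch (n : ℕ) (m : Fin K)
  | fading (n : ℕ) (m : Fin K) (b : Fin A × Fin S)
  | noise (n : ℕ) (b : Fin A × Fin S)
  | phase (n : ℕ)

/-- The round to which a source belongs. -/
def Source.round {K A S : ℕ} : Source K A S → ℕ
  | .batch n _ => n
  | .fading n _ _ => n
  | .noise n _ => n
  | .phase n => n

section Randomness

variable {Ω Z : Type*} [MeasurableSpace Z] {K q d A S : ℕ}

/-- The σ-algebra generated by one source. -/
abbrev Inputs.sigma (X : Inputs Ω Z K q d A S) : Source K A S → MeasurableSpace Ω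
  | .batch n m => MeasurableSpace.comap (X.batch n m) inferInstance
  | .fading n m b => MeasurableSpace.comap (X.fading n m b) inferInstance
  | .noise n b => MeasurableSpace.comap (X.noise n b) inferInstance
  | .phase n => MeasurableSpace.comap (X.phase n) inferInstance

/-- The past of round `n`: everything drawn in the rounds before it. -/
abbrev Inputs.past (X : Inputs Ω Z K q d A S) (n : ℕ) : MeasurableSpace Ω :=
  ⨆ s : Source K A S, ⨆ _ : s.round < n, X.sigma s

/-- Rayleigh fading with additive white Gaussian noise of variance `σn ^ 2`, randomization
symbols on the unit circle, and independent sources. -/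
structure IsRayleighModel [MeasurableSpace Ω] (X : Inputs Ω Z K q d A S) (σn : ℝ≥0)
    (μ : Measure Ω) : Prop where
  measurable_batch : ∀ n m, Measurable (X.batch n m)
  measurable_fading : ∀ n m b, Measurable (X.fading n m b)
  measurable_noise : ∀ n b, Measurable (X.noise n b)
  measurable_phase : ∀ n, Measurable (X.phase n)
  law_fading : ∀ n m b, μ.map (X.fading n m b) = complexGaussian 1
  law_noise : ∀ n b, μ.map (X.noise n b) = complexGaussian (σn ^ 2)
  phase_unit : ∀ n m i, ∀ᵐ ω ∂μ, ‖X.phase n ω m i‖ = 1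
  indep : iIndep X.sigma μ

variable [MeasurableSpace Ω]

/-- The average transmit power of the devices in round `n`. -/
def avgPower (sch : Scheme Z K q d A S) (X : Inputs Ω Z K q d A S) (μ : Measure Ω) (n : ℕ) : ℝ :=
  ∫ ω, (1 / (K : ℝ)) * ∑ m, power sch X n ω m ∂μ

/-- Given the past, the powers used in round `n` are independent of the votes cast on
coordinate `i` in that round. -/
def PowerVoteDecoupled (sch : Scheme Z K q d A S) (X : Inputs Ω Z K q d A S) (μ : Measure Ω)
    (n : ℕ) (i : Fin q) : Prop :=
  ∀ B C : Set (Fin K → ℝ), MeasurableSet B → MeasurableSet C →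
    μ⟦power sch X n ⁻¹' B ∩ coordVotes sch X n i ⁻¹' C | X.past n⟧ =ᵐ[μ]
      fun ω => (μ⟦power sch X n ⁻¹' B | X.past n⟧) ω * (μ⟦coordVotes sch X n i ⁻¹' C | X.past n⟧) ω

/-! ### Assumptions on the loss and on the stochastic gradients -/

/-- Coordinate-wise smoothness with constants `L`. -/
def IsSmooth (F : Model q → ℝ) (L : Fin q → ℝ) : Prop :=
  Differentiable ℝ F ∧ ∀ w w' : Model q,
    |F w' - (F w + ∑ i, gradient F w i * (w' i - w i))| ≤
      (1 / 2) * ∑ i, L i * (w' i - w i) ^ 2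

/-- At every fixed model, the stochastic gradient of every device in every round is unbiased with
coordinate variances at most `σᵢ² / d`. -/
def UnbiasedBoundedVariance (sch : Scheme Z K q d A S) (X : Inputs Ω Z K q d A S) (μ : Measure Ω)
    (D : Measure Z) (σ : Fin q → ℝ) : Prop :=
  ∀ (w : Model q) (n : ℕ) (m : Fin K) (i : Fin q),
    MemLp (fun ω => batchGrad sch w (X.batch n m ω) i) 2 μ ∧
    ∫ ω, batchGrad sch w (X.batch n m ω) i ∂μ = gradient (globalLoss sch D) w i ∧
    ∫ ω, (batchGrad sch w (X.batch n m ω) i - gradient (globalLoss sch D) w i) ^ 2 ∂μ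
      ≤ σ i ^ 2 / d

/-- At every fixed model, each coordinate of each stochastic gradient has a unimodal law that is
symmetric around its mean. -/
def UnimodalSymmetricNoise (sch : Scheme Z K q d A S) (X : Inputs Ω Z K q d A S)
    (μ : Measure Ω) : Prop :=
  ∀ (w : Model q) (n : ℕ) (m : Fin K) (i : Fin q),
    IsUnimodal (μ.map (fun ω => batchGrad sch w (X.batch n m ω) i)) ∧
    IsSymmetricAboutMean (μ.map (fun ω => batchGrad sch w (X.batch n m ω) i))

end Randomness

end FSKMV

end

/-! ### Circular Gaussians and non-coherent energy comparison. -/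

namespace FSKMV

/-! Fix a round and a coordinate, let `c` be the gradient entry there and `s = σ i / √d`. Given
powers and votes, the symbols received on the two bins are independent circular Gaussians, with
variances `a` and `b` equal to `σn²` plus `E₀` times the total power of the devices voting that way.
Their squared moduli are exponential, so the detected sign has mean `(a - b) / (a + b)`
(`integral_sign_energy`, `integral_detect`). If no device votes `0`, then `a + b = E₀ ∑ P + 2 σn²`
does not depend on the votes, and this mean is linear in them with weights `E₀ Pₘ / (a + b)`. For `c
≠ 0` abstention has probability zero, because a symmetric unimodal law has no atom off its centre;
for `c = 0` the coordinate does not enter the first-order term.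

Decoupling lets the votes be averaged while the powers stay fixed (`measure_power_votes_inter`). A
Gauss-type inequality for symmetric unimodal laws (`tail_bound_of_unimodal`) shows that each vote,
multiplied by `sign c`, has a mean `p ≥ 0` with `|c| p ≥ |c| - (√3/4) s`. It remains to bound the
total weight from below. Powers start at `1` and never decrease, while `ϑ ≤ 1` because the average
power of round `0` is exactly `1`. Hence `∑ P ≥ K ϑ` holds surely, not just on average, and the
total weight is at least `κ = 1 / (1 + 2 / (β K))`. This gives `E[c · decision] ≥ κ (E|c| - (√3/4)
s)` (`mean_decision_margin`, `integral_progress`).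

Coordinate-wise smoothness turns this into an expected decrease per round (`integral_loss_succ_le`).
Summing over rounds, using `F ≥ F*` and inserting the step size gives the rate, with `√3/4` relaxed
to `2√2/6` (`rate_of_descent`). Conditioning on the model is elementary throughout: updates lie in a
finite set, so the model of each round takes finitely many values and one works on the events `model
= w`. -/

lemma measurable_complex_mk : Measurable (fun p : ℝ × ℝ => (⟨p.1, p.2⟩ : ℂ)) :=
  Complex.measurableEquivRealProd.symm.measurable

instance isProbabilityMeasure_complexGaussian (v : ℝ≥0) :
    IsProbabilityMeasure (complexGaussian v) :=
  Measure.isProbabilityMeasure_map measurable_complex_mk.aemeasurable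

lemma charFun_complexGaussian (v : ℝ≥0) (t : ℂ) :
    charFun (complexGaussian v) t = Complex.exp (-(v * ‖t‖ ^ 2 / 4 : ℝ)) := by
  rw [charFun_apply, complexGaussian, integral_map measurable_complex_mk.aemeasurable
    (by fun_prop)]
  have h : ∀ p : ℝ × ℝ, Complex.exp ((inner ℝ (⟨p.1, p.2⟩ : ℂ) t : ℝ) * Complex.I) =
      Complex.exp ((t.re : ℂ) * p.1 * Complex.I) * Complex.exp ((t.im : ℂ) * p.2 * Complex.I) := by
    intro p
    rw [← Complex.exp_add, Complex.inner]
    congr 1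
    simp
    ring
  simp_rw [h]
  rw [integral_prod_mul (fun x : ℝ => Complex.exp ((t.re : ℂ) * x * Complex.I))
    (fun y : ℝ => Complex.exp ((t.im : ℂ) * y * Complex.I)), ← charFun_apply_real,
    ← charFun_apply_real, charFun_gaussianReal, charFun_gaussianReal, ← Complex.exp_add]
  congr 1
  rw [← Complex.normSq_eq_norm_sq, Complex.normSq_apply]
  push_cast
  ring

/-- Multiplication by `c` acts on the characteristic function by moving `conj c` to the argument,
and that function depends on the modulus of its argument alone. So phases disappear and only `‖c‖²`
survives. -/
lemma map_const_mul_complexGaussian (c : ℂ) (v : ℝ≥0) :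
    (complexGaussian v).map (fun z => c * z) = complexGaussian (‖c‖₊ ^ 2 * v) := by
  have : IsProbabilityMeasure ((complexGaussian v).map (fun z => c * z)) :=
    Measure.isProbabilityMeasure_map (by fun_prop)
  apply Measure.ext_of_charFun
  ext t
  have h : charFun ((complexGaussian v).map (fun z => c * z)) t =
      charFun (complexGaussian v) ((starRingEnd ℂ) c * t) := by
    rw [charFun_apply, charFun_apply, integral_map (by fun_prop) (by fun_prop)]
    congr 1 with z
    congr 3
    simp only [Complex.inner, Complex.mul_re, map_mul, Complex.conj_re, Complex.conj_im,
      Complex.mul_im]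
    ring
  rw [h, charFun_complexGaussian, charFun_complexGaussian]
  simp
  ring_nf

/-- Linear combinations of independent circular Gaussians are circular Gaussian. -/
lemma map_sum_mul_complexGaussian {Ω ι : Type*} [MeasurableSpace Ω] [Fintype ι] {μ : Measure Ω}
    [IsProbabilityMeasure μ] {Y : ι → Ω → ℂ} (hm : ∀ i, Measurable (Y i)) (hY : iIndepFun Y μ)
    {v : ι → ℝ≥0} (hv : ∀ i, μ.map (Y i) = complexGaussian (v i)) (c : ι → ℂ) :
    μ.map (fun ω => ∑ i, c i * Y i ω) = complexGaussian (∑ i, ‖c i‖₊ ^ 2 * v i) := by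
  have : IsProbabilityMeasure (μ.map (fun ω => ∑ i, c i * Y i ω)) :=
    Measure.isProbabilityMeasure_map (by fun_prop)
  apply Measure.ext_of_charFun
  have h := iIndepFun.charFun_map_fun_sum_eq_prod (X := fun i ω => c i * Y i ω)
    (fun i => ((hm i).const_mul (c i)).aemeasurable)
    (hY.comp (fun i z => c i * z) (fun i => measurable_const_mul _))
  rw [h]
  ext t
  have h2 : ∀ i, μ.map (fun ω => c i * Y i ω) = complexGaussian (‖c i‖₊ ^ 2 * v i) := fun i => by
    rw [← map_const_mul_complexGaussian, ← hv, Measure.map_map (by fun_prop) (hm i)]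
    rfl
  simp_rw [Finset.prod_apply, h2, charFun_complexGaussian, ← Complex.exp_sum]
  congr 1
  push_cast
  rw [Finset.sum_neg_distrib, ← Finset.sum_div, ← Finset.sum_mul]

/-- The squared modulus is exponential with mean `v`: in polar coordinates the density is radial,
and `r exp(-r² / v)` has an explicit primitive. -/
lemma complexGaussian_tail {v : ℝ≥0} (hv : 0 < v) {t : ℝ} (ht : 0 ≤ t) :
    complexGaussian v {z | t < ‖z‖ ^ 2} = ENNReal.ofReal (Real.exp (-t / v)) := by
  have hv2 : v / 2 ≠ 0 := (half_pos hv).ne'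
  have hvr : (0 : ℝ) < v := hv
  have hS : MeasurableSet {p : ℝ × ℝ | t < p.1 ^ 2 + p.2 ^ 2} :=
    measurableSet_lt measurable_const (by fun_prop)
  have h1 : complexGaussian v {z | t < ‖z‖ ^ 2} = ∫⁻ p : ℝ × ℝ,
      {p : ℝ × ℝ | t < p.1 ^ 2 + p.2 ^ 2}.indicator
        (fun p => gaussianPDF 0 (v / 2) p.1 * gaussianPDF 0 (v / 2) p.2) p := by
    rw [complexGaussian, Measure.map_apply measurable_complex_mk
      (measurableSet_lt measurable_const (by fun_prop)),
      gaussianReal_of_var_ne_zero 0 hv2, prod_withDensity (measurable_gaussianPDF _ _)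
      (measurable_gaussianPDF _ _), lintegral_indicator hS, ← Measure.volume_eq_prod]
    have : (fun p : ℝ × ℝ => (⟨p.1, p.2⟩ : ℂ)) ⁻¹' {z | t < ‖z‖ ^ 2} =
        {p : ℝ × ℝ | t < p.1 ^ 2 + p.2 ^ 2} := by
      ext p
      rw [Set.mem_preimage, Set.mem_ofPred_eq, Set.mem_ofPred_eq, ← Complex.normSq_eq_norm_sq,
        Complex.normSq_apply, sq, sq]
    rw [this, withDensity_apply _ hS]
  have h2 : ∀ r θ : ℝ, ENNReal.ofReal r • {p : ℝ × ℝ | t < p.1 ^ 2 + p.2 ^ 2}.indicator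
        (fun p => gaussianPDF 0 (v / 2) p.1 * gaussianPDF 0 (v / 2) p.2)
        (polarCoord.symm (r, θ)) = {r : ℝ | t < r ^ 2}.indicator (fun r =>
          ENNReal.ofReal (r * ((Real.pi * v)⁻¹ * Real.exp (-(r ^ 2) / v)))) r := by
    intro r θ
    have hr : (r * Real.cos θ) ^ 2 + (r * Real.sin θ) ^ 2 = r ^ 2 := by
      nlinarith [Real.sin_sq_add_cos_sq θ]
    simp only [polarCoord_symm_apply, Set.indicator, Set.mem_ofPred_eq, hr, gaussianPDF,
      gaussianPDFReal]
    split_ifs with h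
    · rw [← ENNReal.ofReal_mul (by positivity), smul_eq_mul]
      by_cases hr0 : 0 ≤ r
      · rw [← ENNReal.ofReal_mul hr0]
        congr 2
        rw [mul_mul_mul_comm, ← mul_inv, ← Real.exp_add, Real.mul_self_sqrt (by positivity)]
        congr 2
        · push_cast; ring
        · rw [← hr]; push_cast; field_simp; ring
      -- For nonpositive `r` both sides vanish through the truncation in `ENNReal.ofReal`, so the
      -- identity holds without restricting to the polar domain.
      · have hr1 : r ≤ 0 := (not_le.1 hr0).le
        rw [ENNReal.ofReal_of_nonpos hr1, ENNReal.ofReal_of_nonpos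
          (mul_nonpos_of_nonpos_of_nonneg hr1 (by positivity)), zero_mul]
    · simp
  rw [h1, ← lintegral_comp_polarCoord_symm, polarCoord_target]
  have h3 : ∀ p : ℝ × ℝ, ENNReal.ofReal p.1 • {p : ℝ × ℝ | t < p.1 ^ 2 + p.2 ^ 2}.indicator
        (fun p => gaussianPDF 0 (v / 2) p.1 * gaussianPDF 0 (v / 2) p.2)
        (polarCoord.symm p) = {r : ℝ | t < r ^ 2}.indicator (fun r =>
          ENNReal.ofReal (r * ((Real.pi * v)⁻¹ * Real.exp (-(r ^ 2) / v)))) p.1 * 1 := fun p => by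
    rw [mul_one]; exact h2 p.1 p.2
  have hT : MeasurableSet {r : ℝ | t < r ^ 2} := measurableSet_lt measurable_const (by fun_prop)
  simp_rw [h3]
  rw [Measure.volume_eq_prod, ← Measure.prod_restrict, lintegral_prod_mul
    (((by fun_prop : Measurable _).indicator hT).aemeasurable) aemeasurable_const,
    lintegral_const, Measure.restrict_apply_univ, Real.volume_Ioo, one_mul,
    setLIntegral_indicator hT]
  have h4 : {r : ℝ | t < r ^ 2} ∩ Set.Ioi 0 = Set.Ioi (Real.sqrt t) := by
    ext r
    simp only [Set.mem_inter_iff, Set.mem_ofPred_eq, Set.mem_Ioi]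
    constructor
    · rintro ⟨h, h'⟩
      exact (Real.sqrt_lt' h').2 h
    · intro h
      have h' := (Real.sqrt_nonneg t).trans_lt h
      exact ⟨(Real.sqrt_lt' h').1 h, h'⟩
  rw [h4]
  have hder : ∀ x ∈ Set.Ici (Real.sqrt t), HasDerivAt
      (fun r : ℝ => -(2 * Real.pi)⁻¹ * Real.exp (-(r ^ 2) / v))
      (x * ((Real.pi * v)⁻¹ * Real.exp (-(x ^ 2) / v))) x := by
    intro x _
    have := ((((hasDerivAt_pow 2 x).neg).div_const (v : ℝ)).exp).const_mul (-(2 * Real.pi)⁻¹)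
    refine this.congr_deriv ?_
    simp only [Pi.neg_apply]
    push_cast
    field_simp
  have hpos : ∀ x ∈ Set.Ioi (Real.sqrt t),
      0 ≤ x * ((Real.pi * v)⁻¹ * Real.exp (-(x ^ 2) / v)) := fun x hx => by
    have : 0 ≤ x := (Real.sqrt_nonneg t).trans (le_of_lt hx)
    positivity
  have hlim : Filter.Tendsto (fun r : ℝ => -(2 * Real.pi)⁻¹ * Real.exp (-(r ^ 2) / v))
      Filter.atTop (nhds 0) := by
    rw [← mul_zero (-(2 * Real.pi)⁻¹)]
    apply Filter.Tendsto.const_mul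
    apply Real.tendsto_exp_atBot.comp
    have : Filter.Tendsto (fun r : ℝ => r ^ 2 / v) Filter.atTop Filter.atTop :=
      (Filter.tendsto_pow_atTop two_ne_zero).atTop_div_const hvr
    refine (Filter.tendsto_neg_atTop_atBot.comp this).congr fun r => ?_
    simp [neg_div]
  rw [← ofReal_integral_eq_lintegral_ofReal
    (integrableOn_Ioi_deriv_of_nonneg' hder hpos hlim)
    ((ae_restrict_iff' measurableSet_Ioi).2 (ae_of_all _ hpos)),
    integral_Ioi_of_hasDerivAt_of_nonneg' hder hpos hlim, ← ENNReal.ofReal_mul]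
  · congr 1
    rw [Real.sq_sqrt ht]
    field_simp
    ring
  · rw [Real.sq_sqrt ht]
    simp
    positivity

lemma integral_exp_neg_sq_gaussianReal {v : ℝ≥0} (hv : 0 < v) {s : ℝ} (hs : 0 ≤ s) :
    ∫ x, Real.exp (-s * x ^ 2) ∂(gaussianReal 0 v) = (Real.sqrt (1 + 2 * s * v))⁻¹ := by
  have hvr : (0 : ℝ) < v := hv
  rw [integral_gaussianReal_eq_integral_smul hv.ne']
  have h : ∀ x : ℝ, gaussianPDFReal 0 v x • Real.exp (-s * x ^ 2) =
      (Real.sqrt (2 * Real.pi * v))⁻¹ * Real.exp (-((2 * (v : ℝ))⁻¹ + s) * x ^ 2) := fun x => by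
    rw [gaussianPDFReal, smul_eq_mul, mul_assoc, ← Real.exp_add]
    congr 2
    field_simp
    ring
  simp_rw [h]
  rw [integral_const_mul, integral_gaussian, ← Real.sqrt_inv, ← Real.sqrt_inv,
    ← Real.sqrt_mul (by positivity)]
  congr 1
  field_simp

lemma integral_exp_neg_sq_complexGaussian {v : ℝ≥0} (hv : 0 < v) {s : ℝ} (hs : 0 ≤ s) :
    ∫ z, Real.exp (-s * ‖z‖ ^ 2) ∂(complexGaussian v) = (1 + s * v)⁻¹ := by
  rw [complexGaussian, integral_map measurable_complex_mk.aemeasurable (by fun_prop)]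
  have h : ∀ p : ℝ × ℝ, Real.exp (-s * ‖(⟨p.1, p.2⟩ : ℂ)‖ ^ 2) =
      Real.exp (-s * p.1 ^ 2) * Real.exp (-s * p.2 ^ 2) := fun p => by
    rw [← Real.exp_add, ← Complex.normSq_eq_norm_sq, Complex.normSq_apply]
    congr 1
    ring
  simp_rw [h]
  rw [integral_prod_mul (fun x : ℝ => Real.exp (-s * x ^ 2)) (fun x : ℝ => Real.exp (-s * x ^ 2)),
    integral_exp_neg_sq_gaussianReal (half_pos hv) hs, ← mul_inv, Real.mul_self_sqrt]
  · push_cast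
    ring
  · positivity

/-- Conditioning on the first variable and using the exponential tail of the second leaves `E
exp(-‖z‖² / b)`, a Laplace transform equal to `(1 + a / b)⁻¹`. -/
lemma prob_norm_sq_lt_complexGaussian {a b : ℝ≥0} (ha : 0 < a) (hb : 0 < b) :
    ((complexGaussian a).prod (complexGaussian b)).real {p | ‖p.1‖ ^ 2 < ‖p.2‖ ^ 2} =
      b / (a + b) := by
  have har : (0 : ℝ) < a := ha
  have hbr : (0 : ℝ) < b := hb
  have hS : MeasurableSet {p : ℂ × ℂ | ‖p.1‖ ^ 2 < ‖p.2‖ ^ 2} :=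
    measurableSet_lt (by fun_prop) (by fun_prop)
  have h : ∀ z : ℂ, complexGaussian b (Prod.mk z ⁻¹' {p | ‖p.1‖ ^ 2 < ‖p.2‖ ^ 2}) =
      ENNReal.ofReal (Real.exp (-(1 / b) * ‖z‖ ^ 2)) := fun z => by
    have := complexGaussian_tail hb (sq_nonneg ‖z‖)
    rw [show -(‖z‖ ^ 2) / (b : ℝ) = -(1 / b) * ‖z‖ ^ 2 by ring] at this
    exact this
  rw [measureReal_def, Measure.prod_apply hS]
  simp_rw [h]
  rw [← integral_eq_lintegral_of_nonneg_ae (ae_of_all _ fun _ => (Real.exp_pos _).le)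
    (by fun_prop), integral_exp_neg_sq_complexGaussian ha (by positivity)]
  field_simp
  ring

/-- Mean decision of a non-coherent energy comparison of two independent Rayleigh branches. -/
lemma integral_sign_energy {a b : ℝ≥0} (ha : 0 < a) (hb : 0 < b) :
    ∫ p, Real.sign (‖p.1‖ ^ 2 - ‖p.2‖ ^ 2) ∂((complexGaussian a).prod (complexGaussian b)) =
      ((a : ℝ) - b) / (a + b) := by
  set ν := (complexGaussian a).prod (complexGaussian b)
  have hS : MeasurableSet {p : ℂ × ℂ | ‖p.1‖ ^ 2 < ‖p.2‖ ^ 2} :=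
    measurableSet_lt (by fun_prop) (by fun_prop)
  have hT : MeasurableSet {p : ℂ × ℂ | ‖p.2‖ ^ 2 < ‖p.1‖ ^ 2} :=
    measurableSet_lt (by fun_prop) (by fun_prop)
  have h : ∀ p : ℂ × ℂ, Real.sign (‖p.1‖ ^ 2 - ‖p.2‖ ^ 2) =
      {p : ℂ × ℂ | ‖p.2‖ ^ 2 < ‖p.1‖ ^ 2}.indicator (fun _ => (1 : ℝ)) p -
      {p : ℂ × ℂ | ‖p.1‖ ^ 2 < ‖p.2‖ ^ 2}.indicator (fun _ => (1 : ℝ)) p := fun p => by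
    simp only [Set.indicator, Set.mem_ofPred_eq]
    rcases lt_trichotomy (‖p.1‖ ^ 2) (‖p.2‖ ^ 2) with h | h | h
    · rw [Real.sign_of_neg (by linarith), if_neg h.le.not_gt, if_pos h]; norm_num
    · simp [h]
    · rw [Real.sign_of_pos (by linarith), if_pos h, if_neg h.le.not_gt]; norm_num
  simp_rw [h]
  rw [integral_sub ((integrable_const _).indicator hT) ((integrable_const _).indicator hS),
    integral_indicator_const _ hS, integral_indicator_const _ hT,
    prob_norm_sq_lt_complexGaussian ha hb]
  have hsw : ν.real {p : ℂ × ℂ | ‖p.2‖ ^ 2 < ‖p.1‖ ^ 2} = a / (b + a) := by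
    rw [← prob_norm_sq_lt_complexGaussian hb ha, measureReal_def, measureReal_def,
      ← Measure.prod_swap, Measure.map_apply measurable_swap hS]
    rfl
  rw [hsw]
  simp
  rw [add_comm (b : ℝ), sub_div]

/-! ### A Gauss-type inequality for convex tails. -/

lemma exists_subgradient_of_convexOn_Ioi {H : ℝ → ℝ} {a S : ℝ} (hH : ConvexOn ℝ (Set.Ioi a) H)
    (hS : a < S) : ∃ m : ℝ, ∀ y, a < y → H S + m * (y - S) ≤ H y := by
  have hSi : S ∈ interior (Set.Ioi a) := by rwa [interior_Ioi]
  refine ⟨derivWithin H (Set.Ioi S) S, fun y hy => ?_⟩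
  rcases lt_trichotomy y S with h | rfl | h
  · have h1 := (hH.slope_le_leftDeriv_of_mem_interior hy hSi h).trans
      (hH.leftDeriv_le_rightDeriv_of_mem_interior hSi)
    rw [slope_def_field, div_le_iff₀ (by linarith)] at h1
    linarith
  · simp
  · have h1 := hH.rightDeriv_le_slope_of_mem_interior hSi hy h
    rw [slope_def_field, le_div_iff₀ (by linarith)] at h1
    linarith

/-- A convex tail function bounded by `1 / 2` whose second moment is at most `V / 2` (tested on
triangles below the graph) satisfies a sharp bound of Gauss type. -/
lemma convex_tail_bound {H : ℝ → ℝ} {V S : ℝ} (hH : ConvexOn ℝ (Set.Ioi 0) H)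
    (h0 : ∀ t, 0 < t → 0 ≤ H t) (h1 : ∀ t, 0 < t → H t ≤ 1 / 2)
    (hV : ∀ b k : ℝ, 0 < b → 0 ≤ k → (∀ t, 0 < t → t < b → k * (b - t) ≤ H t) →
      2 * k * b ^ 3 / 3 ≤ V) (hS : 0 < S) :
    (S * H S) ^ 2 ≤ 3 * V / 64 := by
  have hV0 : 0 ≤ V := by
    simpa using hV 1 0 one_pos le_rfl (fun t ht _ => by simpa using h0 t ht)
  obtain ⟨m, hm⟩ := exists_subgradient_of_convexOn_Ioi hH hS
  rcases (h0 S hS).eq_or_lt with hp | hp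
  · rw [← hp]; nlinarith
  -- The supporting line at `S` must slope down: a rising line would pass `1 / 2`, and a level one
  -- would put arbitrarily large triangles below the graph, against the bound `V`.
  have hm0 : m < 0 := by
    by_contra hm0
    push Not at hm0
    rcases hm0.eq_or_lt with h | h
    · subst h
      have hb : ∀ b : ℝ, 0 < b → 2 * H S * b ^ 2 / 3 ≤ V := fun b hb => by
        have := hV b (H S / b) hb (by positivity) (fun t ht htb => by
          have h2 := hm t ht
          have : H S / b * (b - t) ≤ H S := by
            rw [div_mul_eq_mul_div, div_le_iff₀ hb]
            nlinarith
          linarith)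
        calc _ = 2 * (H S / b) * b ^ 3 / 3 := by field_simp
          _ ≤ V := this
      -- At this width the triangle already forces `(2/3) (H S + 2 V) ≤ V`, which is impossible.
      have hb2 := hb (1 + V / H S) (by positivity)
      have h3 : 2 * H S * (1 + V / H S) ^ 2 / 3 = 2 / 3 * (H S + 2 * V + V ^ 2 / H S) := by
        field_simp; ring
      have h4 : 0 ≤ V ^ 2 / H S := by positivity
      rw [h3] at hb2
      linarith
    · have := hm (S + 1 / m) (by positivity)
      have h2 := h1 (S + 1 / m) (by positivity)
      have h3 : m * (S + 1 / m - S) = 1 := by field_simp; ring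
      linarith
  set k := -m with hk
  have hk0 : 0 < k := by linarith
  -- `b` is the zero of the supporting line, which therefore reads `k (b - t)`.
  set b := S + H S / k with hb
  have hbS : S < b := by rw [hb]; linarith [div_pos hp hk0]
  have hpk : H S = k * (b - S) := by rw [hb]; field_simp; ring
  have hline : ∀ t, 0 < t → k * (b - t) ≤ H t := fun t ht => by
    have := hm t ht
    nlinarith
  -- The height of the triangle at the origin, obtained as a limit since `H` is controlled only on
  -- `t > 0`.
  have hkb : k * b ≤ 1 / 2 := by
    have ht : Filter.Tendsto (fun t : ℝ => k * (b - t)) (nhdsWithin 0 (Set.Ioi 0))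
        (nhds (k * (b - 0))) :=
      ((continuous_const.mul (continuous_const.sub continuous_id)).tendsto 0).mono_left
        nhdsWithin_le_nhds
    rw [sub_zero] at ht
    exact le_of_tendsto ht (Filter.eventually_of_mem self_mem_nhdsWithin
      fun t ht => (hline t ht).trans (h1 t ht))
  have hvol := hV b k (hS.trans hbS) hk0.le (fun t ht _ => hline t ht)
  have hb0 : 0 < b := hS.trans hbS
  have h5 : S * H S ≤ k * b ^ 2 / 4 := by
    rw [hpk]
    have : S * (b - S) ≤ b ^ 2 / 4 := by nlinarith [sq_nonneg (b - 2 * S)]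
    nlinarith
  have h6 : 0 ≤ S * H S := by positivity
  -- Splitting `(k b²)²` as `(k b)(k b³)` uses both constraints, height at most `1 / 2` and second
  -- moment at most `V`; hence `1/2 · 3/2 · 1/16 = 3/64`.
  calc (S * H S) ^ 2 ≤ (k * b ^ 2 / 4) ^ 2 := by gcongr
    _ = (k * b) * (k * b ^ 3) / 16 := by ring
    _ ≤ (1 / 2) * (k * b ^ 3) / 16 := by gcongr
    _ ≤ 3 * V / 64 := by linarith

/-! ### Signs of samples from symmetric unimodal laws. -/

section Unimodal

variable {ν : Measure ℝ} {c : ℝ}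

lemma symm_preimage (hs : ν.map (fun x => 2 * c - x) = ν) {s : Set ℝ} (hm : MeasurableSet s) :
    ν.real ((fun x => 2 * c - x) ⁻¹' s) = ν.real s := by
  conv_rhs => rw [← hs]
  rw [map_measureReal_apply (by fun_prop) hm]

lemma symm_Ici (hs : ν.map (fun x => 2 * c - x) = ν) (t : ℝ) :
    ν.real (Set.Ici (c + t)) = ν.real (Set.Iic (c - t)) := by
  rw [← symm_preimage hs measurableSet_Iic]
  congr 1
  ext x
  simp only [Set.mem_Ici, Set.mem_preimage, Set.mem_Iic]
  constructor <;> intro h <;> linarith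

lemma symm_Ioi (hs : ν.map (fun x => 2 * c - x) = ν) (t : ℝ) :
    ν.real (Set.Ioi (c + t)) = ν.real (Set.Iio (c - t)) := by
  rw [← symm_preimage hs measurableSet_Iio]
  congr 1
  ext x
  simp only [Set.mem_Ioi, Set.mem_preimage, Set.mem_Iio]
  constructor <;> intro h <;> linarith

variable [IsProbabilityMeasure ν]

lemma symm_tail_le_half (hs : ν.map (fun x => 2 * c - x) = ν) {t : ℝ} (ht : 0 < t) :
    ν.real (Set.Iic (c - t)) ≤ 1 / 2 := by
  have h := measureReal_union (μ := ν) (s₁ := Set.Iic (c - t)) (s₂ := Set.Ici (c + t))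
    (Set.disjoint_left.2 fun x hx hx' => by
      simp only [Set.mem_Iic, Set.mem_Ici] at hx hx'; linarith) measurableSet_Ici
  rw [symm_Ici hs] at h
  have h1 : ν.real (Set.Iic (c - t) ∪ Set.Ici (c + t)) ≤ 1 := measureReal_le_one
  linarith

lemma symm_two_tails (hs : ν.map (fun x => 2 * c - x) = ν) {t : ℝ} (ht : 0 < t) :
    ν.real {x | t ≤ |x - c|} = 2 * ν.real (Set.Iic (c - t)) := by
  have h := measureReal_union (μ := ν) (s₁ := Set.Iic (c - t)) (s₂ := Set.Ici (c + t))
    (Set.disjoint_left.2 fun x hx hx' => by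
      simp only [Set.mem_Iic, Set.mem_Ici] at hx hx'; linarith) measurableSet_Ici
  rw [symm_Ici hs] at h
  rw [two_mul, ← h]
  congr 1
  ext x
  simp only [Set.mem_ofPred_eq, le_abs, Set.mem_union, Set.mem_Iic, Set.mem_Ici]
  constructor
  · rintro (h | h)
    · right; linarith
    · left; linarith
  · rintro (h | h)
    · right; linarith
    · left; linarith

/-- A triangle below the one-sided tail of a symmetric law bounds its variance from below. -/
lemma variance_ge_of_triangle_le_tail (hs : ν.map (fun x => 2 * c - x) = ν)
    (hL : Integrable (fun x => (x - c) ^ 2) ν) {b k : ℝ} (hb : 0 < b) (hk : 0 ≤ k)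
    (h : ∀ t, 0 < t → t < b → k * (b - t) ≤ ν.real (Set.Iic (c - t))) :
    2 * k * b ^ 3 / 3 ≤ ∫ x, (x - c) ^ 2 ∂ν := by
  have hcont : Continuous fun t : ℝ => 4 * k * (b - t) * t := by fun_prop
  have hint : ∫ t in (0 : ℝ)..b, 4 * k * (b - t) * t = 2 * k * b ^ 3 / 3 := by
    have hd : ∀ t ∈ Set.uIcc 0 b, HasDerivAt (fun t : ℝ => 4 * k * (b * t ^ 2 / 2 - t ^ 3 / 3))
        (4 * k * (b - t) * t) t := fun t _ => by
      have := ((((hasDerivAt_pow 2 t).const_mul b).div_const 2).sub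
        ((hasDerivAt_pow 3 t).div_const 3)).const_mul (4 * k)
      refine this.congr_deriv ?_
      push_cast
      ring
    rw [intervalIntegral.integral_eq_sub_of_hasDerivAt hd (hcont.intervalIntegrable _ _)]
    ring
  -- Layer cake: the variance is `2 ∫ t ν{|x - c| ≥ t} dt`, which by symmetry is `4 ∫ t · tail(t)
  -- dt`; the triangle contributes `2 k b³ / 3`.
  have hlayer := lintegral_rpow_eq_lintegral_meas_le_mul ν (f := fun x => |x - c|)
    (ae_of_all _ fun x => abs_nonneg _) (by fun_prop) (p := 2) two_pos
  have hle : ENNReal.ofReal (2 * k * b ^ 3 / 3) ≤ ∫⁻ x, ENNReal.ofReal ((x - c) ^ 2) ∂ν := by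
    have e1 : ∫⁻ x, ENNReal.ofReal ((x - c) ^ 2) ∂ν =
        ∫⁻ x, ENNReal.ofReal (|x - c| ^ (2 : ℝ)) ∂ν := by
      congr 1 with x
      rw [Real.rpow_two, sq_abs]
    rw [e1, hlayer, ← lintegral_const_mul' _ _ ENNReal.ofReal_ne_top, ← hint,
      intervalIntegral.integral_of_le hb.le, integral_Ioc_eq_integral_Ioo,
      ofReal_integral_eq_lintegral_ofReal (hcont.integrableOn_Icc.mono_set Set.Ioo_subset_Icc_self)
      ((ae_restrict_iff' measurableSet_Ioo).2 (ae_of_all _ fun t ht => by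
        have h1 : 0 ≤ b - t := by linarith [ht.2]
        have h2 : 0 ≤ t := ht.1.le
        simp only [Pi.zero_apply]
        positivity))]
    refine (setLIntegral_mono' measurableSet_Ioo fun t ht => ?_).trans
      (lintegral_mono_set Set.Ioo_subset_Ioi_self)
    have ht0 : 0 < t := ht.1
    have e2 : ν {a | t ≤ |a - c|} = ENNReal.ofReal (2 * ν.real (Set.Iic (c - t))) := by
      rw [← symm_two_tails hs ht0, ofReal_measureReal]
    rw [e2, ← ENNReal.ofReal_mul (by positivity), ← ENNReal.ofReal_mul two_pos.le]
    apply ENNReal.ofReal_le_ofReal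
    have := h t ht0 ht.2
    norm_num
    nlinarith
  rw [← ofReal_integral_eq_lintegral_ofReal hL (ae_of_all _ fun x => sq_nonneg _)] at hle
  exact (ENNReal.ofReal_le_ofReal_iff (integral_nonneg fun x => sq_nonneg _)).1 hle

/-- For a symmetric unimodal law, a convex function separates the open and the closed tails. -/
lemma exists_convex_tail (hu : IsUnimodal ν) (hs : ν.map (fun x => 2 * c - x) = ν) :
    ∃ H : ℝ → ℝ, ConvexOn ℝ (Set.Ioi 0) H ∧
      ∀ t, ν.real (Set.Iio (c - t)) ≤ H t ∧ H t ≤ ν.real (Set.Iic (c - t)) := by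
  obtain ⟨a, hconv, hconc⟩ := hu
  -- The mode need not be the centre. One of the two tails away from `c` avoids it: the right one if
  -- `a ≤ c`, the left one otherwise. Reflection exchanges open tails with open and closed with
  -- closed, so possible atoms leave only a sandwich.
  by_cases hac : a ≤ c
  · refine ⟨fun t => 1 - cdf ν (c + t), ?_, fun t => ?_⟩
    · refine ⟨convex_Ioi 0, fun x hx y hy p r hp hr hpr => ?_⟩
      have := hconc.2 (x := c + x) (by simp at hx ⊢; linarith) (y := c + y)
        (by simp at hy ⊢; linarith) hp hr hpr
      simp only [smul_eq_mul] at this ⊢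
      rw [show p * (c + x) + r * (c + y) = c + (p * x + r * y) by
        linear_combination c * hpr] at this
      linear_combination this - hpr
    · have e : 1 - cdf ν (c + t) = ν.real (Set.Ioi (c + t)) := by
        rw [cdf_eq_real, ← Set.compl_Iic, probReal_compl_eq_one_sub measurableSet_Iic]
      simp only [e]
      refine ⟨(symm_Ioi hs t).ge, ?_⟩
      rw [← symm_Ici hs]
      exact measureReal_mono Set.Ioi_subset_Ici_self
  · push Not at hac
    refine ⟨fun t => cdf ν (c - t), ?_, fun t => ?_⟩
    · refine ⟨convex_Ioi 0, fun x hx y hy p r hp hr hpr => ?_⟩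
      have := hconv.2 (x := c - x) (by simp at hx ⊢; linarith) (y := c - y)
        (by simp at hy ⊢; linarith) hp hr hpr
      simp only [smul_eq_mul] at this ⊢
      rwa [show p * (c - x) + r * (c - y) = c - (p * x + r * y) by
        linear_combination c * hpr] at this
    · simp only [cdf_eq_real]
      exact ⟨measureReal_mono Set.Iio_subset_Iic_self, le_rfl⟩

/-- Gauss-type inequality for a symmetric unimodal law with variance at most `s ^ 2`. -/
lemma tail_bound_of_unimodal (hu : IsUnimodal ν) (hs : ν.map (fun x => 2 * c - x) = ν)
    (hL : Integrable (fun x => (x - c) ^ 2) ν) {s : ℝ} (hs0 : 0 ≤ s)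
    (hvar : ∫ x, (x - c) ^ 2 ∂ν ≤ s ^ 2) {g : ℝ} (hg : 0 < g) :
    g * ν.real (Set.Iic (c - g)) ≤ Real.sqrt 3 / 8 * s := by
  obtain ⟨H, hH, hHb⟩ := exists_convex_tail hu hs
  have key : ∀ S, 0 < S → S * H S ≤ Real.sqrt 3 / 8 * s := fun S hS => by
    have h := convex_tail_bound (V := s ^ 2) hH
      (fun t _ => measureReal_nonneg.trans (hHb t).1)
      (fun t ht => (hHb t).2.trans (symm_tail_le_half hs ht))
      (fun b k hb hk h => (variance_ge_of_triangle_le_tail hs hL hb hk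
        fun t ht htb => (h t ht htb).trans (hHb t).2).trans hvar) hS
    apply le_of_sq_le_sq _ (by positivity)
    calc _ ≤ _ := h
      _ = _ := by rw [mul_pow, div_pow, Real.sq_sqrt (by norm_num)]; ring
  -- `H` is only known to dominate the open tail, so the closed tail at `g` is compared with `H S`
  -- for `S < g`, and then `S` tends to `g`.
  have ht : Filter.Tendsto (fun S : ℝ => S * ν.real (Set.Iic (c - g))) (nhdsWithin g (Set.Iio g))
      (nhds (g * ν.real (Set.Iic (c - g)))) :=
    ((continuous_id.mul continuous_const).tendsto g).mono_left nhdsWithin_le_nhds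
  refine le_of_tendsto ht ?_
  filter_upwards [Ioo_mem_nhdsLT hg] with S hS
  refine le_trans ?_ (key S hS.1)
  refine mul_le_mul_of_nonneg_left (le_trans ?_ (hHb S).1) hS.1.le
  refine measureReal_mono fun x hx => ?_
  simp only [Set.mem_Iic, Set.mem_Iio] at hx ⊢
  linarith [hS.2]

/-- A unimodal law symmetric about `c` has no atom away from `c`. -/
lemma measure_singleton_of_unimodal (hu : IsUnimodal ν) (hs : ν.map (fun x => 2 * c - x) = ν)
    {x : ℝ} (hx : x ≠ c) : ν.real {x} = 0 := by
  obtain ⟨a, hconv, hconc⟩ := hu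
  have main : ∀ y, y ≠ a → ν.real {y} = 0 := fun y hy => by
    have hcont : ContinuousAt (cdf ν) y := by
      rcases hy.lt_or_gt with h | h
      · exact (hconv.continuousOn isOpen_Iio).continuousAt (Iio_mem_nhds h)
      · exact (hconc.continuousOn isOpen_Ioi).continuousAt (Ioi_mem_nhds h)
    rw [measureReal_def, ← measure_cdf ν, StieltjesFunction.measure_singleton,
      hcont.continuousWithinAt.leftLim_eq]
    simp
  -- The distribution function is continuous off the mode. A mode different from `c` is moved by the
  -- reflection, and its image carries no atom.
  by_cases hxa : x = a
  · have h : ν.real {2 * c - x} = 0 := main _ fun h => hx (by linarith)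
    rw [← symm_preimage hs (measurableSet_singleton _)] at h
    convert h using 2
    ext y
    simp only [Set.mem_singleton_iff, Set.mem_preimage]
    constructor <;> intro h <;> linarith
  · exact main x hxa

lemma measurable_sign : Measurable Real.sign :=
  Measurable.ite measurableSet_Iio measurable_const
    (Measurable.ite measurableSet_Ioi measurable_const measurable_const)

lemma abs_sign_le_one (r : ℝ) : |Real.sign r| ≤ 1 := by
  rcases Real.sign_apply_eq r with h | h | h <;> simp [h]

lemma integrable_sign_comp {Ω : Type*} [MeasurableSpace Ω] {μ : Measure Ω} [IsFiniteMeasure μ]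
    {f : Ω → ℝ} (hf : Measurable f) : Integrable (fun ω => Real.sign (f ω)) μ :=
  Integrable.of_bound (measurable_sign.comp hf).aestronglyMeasurable 1
    (ae_of_all _ fun _ => abs_sign_le_one _)

/-- The product of signs is `1` except on the closed half-line on the wrong side of `0`, where it is
at least `-1`. That half-line includes `0` itself, hence the closed tail. -/
lemma one_sub_two_mul_tail_le_integral_sign (hs : ν.map (fun x => 2 * c - x) = ν) (hc : c ≠ 0) :
    1 - 2 * ν.real (Set.Iic (c - |c|)) ≤ ∫ x, Real.sign c * Real.sign x ∂ν := by
  have hint : Integrable (fun x => Real.sign c * Real.sign x) ν :=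
    (integrable_sign_comp measurable_id).const_mul _
  rcases hc.lt_or_gt with h | h
  · rw [abs_of_neg h, ← symm_Ici hs]
    have e : c + -c = 0 := by ring
    rw [e]
    have : 1 - 2 * ν.real (Set.Ici 0) =
        ∫ x, (1 - 2 * (Set.Ici (0 : ℝ)).indicator (fun _ => (1 : ℝ)) x) ∂ν := by
      rw [integral_sub (integrable_const _)
        (((integrable_const _).indicator measurableSet_Ici).const_mul _), integral_const_mul,
        integral_indicator_const _ measurableSet_Ici]
      simp
    rw [this]
    refine integral_mono ((integrable_const _).sub
      (((integrable_const _).indicator measurableSet_Ici).const_mul _)) hint fun x => ?_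
    simp only [Real.sign_of_neg h, Set.indicator, Set.mem_Ici]
    split_ifs with hx
    · linarith [(abs_le.1 (abs_sign_le_one x)).2]
    · rw [Real.sign_of_neg (not_le.1 hx)]; norm_num
  · rw [abs_of_pos h, sub_self]
    have : 1 - 2 * ν.real (Set.Iic 0) =
        ∫ x, (1 - 2 * (Set.Iic (0 : ℝ)).indicator (fun _ => (1 : ℝ)) x) ∂ν := by
      rw [integral_sub (integrable_const _)
        (((integrable_const _).indicator measurableSet_Iic).const_mul _), integral_const_mul,
        integral_indicator_const _ measurableSet_Iic]
      simp
    rw [this]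
    refine integral_mono ((integrable_const _).sub
      (((integrable_const _).indicator measurableSet_Iic).const_mul _)) hint fun x => ?_
    simp only [Real.sign_of_pos h, Set.indicator, Set.mem_Iic]
    split_ifs with hx
    · linarith [(abs_le.1 (abs_sign_le_one x)).1]
    · rw [Real.sign_of_pos (not_le.1 hx)]; norm_num

lemma integral_sign_nonneg (hs : ν.map (fun x => 2 * c - x) = ν) (hc : c ≠ 0) :
    0 ≤ ∫ x, Real.sign c * Real.sign x ∂ν := by
  linarith [one_sub_two_mul_tail_le_integral_sign hs hc,
    symm_tail_le_half hs (abs_pos.2 hc)]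

/-- The sign of a sample of a symmetric unimodal law agrees on average with the sign of its mean,
up to a loss proportional to the standard deviation. -/
lemma abs_mul_integral_sign_ge (hu : IsUnimodal ν) (hs : ν.map (fun x => 2 * c - x) = ν)
    (hL : Integrable (fun x => (x - c) ^ 2) ν) {s : ℝ} (hs0 : 0 ≤ s)
    (hvar : ∫ x, (x - c) ^ 2 ∂ν ≤ s ^ 2) (hc : c ≠ 0) :
    |c| - Real.sqrt 3 / 4 * s ≤ |c| * ∫ x, Real.sign c * Real.sign x ∂ν := by
  have h1 := mul_le_mul_of_nonneg_left (one_sub_two_mul_tail_le_integral_sign hs hc) (abs_nonneg c)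
  have h2 := tail_bound_of_unimodal hu hs hL hs0 hvar (abs_pos.2 hc)
  linarith

end Unimodal

/-! ### Measurability along the run and what each round knows. -/

section Measurability

variable {Ω Z : Type*} {K q d A S : ℕ}

lemma measurable_agreement (m : Fin K) :
    Measurable (fun g : Fin K → Fin q → ℝ => agreement g m) := by
  unfold agreement
  refine Measurable.abs ((Finset.measurable_sum _ fun i _ => ?_).const_mul _)
  refine Measurable.ite (measurableSet_eq_fun (by fun_prop) ?_) measurable_const measurable_const
  exact measurable_sign.comp (by fun_prop)

lemma measurable_rxSymbol (sch : Scheme Z K q d A S) (i : Fin q) (s : Bool) :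
    Measurable (fun p : ((Fin K → ℝ) × (Fin K → Fin q → ℝ) × (Fin K → Fin q → ℂ)) ×
        (Fin K → Fin A × Fin S → ℂ) × (Fin A × Fin S → ℂ) =>
      rxSymbol sch p.1.1 p.1.2.1 p.2.1 p.2.2 p.1.2.2 i s) := by
  unfold rxSymbol txSymbol
  refine Measurable.add (Finset.measurable_sum _ fun m _ => Measurable.mul ?_ ?_) (by fun_prop)
  · exact Measurable.mul (Complex.measurable_ofReal.comp (by fun_prop)) (by fun_prop)
  · exact Measurable.ite (measurableSet_eq_fun (by fun_prop) measurable_const) (by fun_prop)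
      measurable_const

lemma measurable_detect (sch : Scheme Z K q d A S) (i : Fin q) :
    Measurable (fun p : ((Fin K → ℝ) × (Fin K → Fin q → ℝ) × (Fin K → Fin q → ℂ)) ×
        (Fin K → Fin A × Fin S → ℂ) × (Fin A × Fin S → ℂ) =>
      detect sch p.1.1 p.1.2.1 p.2.1 p.2.2 p.1.2.2 i) := by
  unfold detect
  exact measurable_sign.comp (((measurable_rxSymbol sch i true).norm.pow_const 2).sub
    ((measurable_rxSymbol sch i false).norm.pow_const 2))

lemma model_succ (sch : Scheme Z K q d A S) (X : Inputs Ω Z K q d A S) (n : ℕ) (ω : Ω) :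
    model sch X (n + 1) ω = model sch X n ω - sch.stepSize • WithLp.toLp 2
      (detect sch (power sch X n ω) (votes sch (model sch X n ω) fun m => X.batch n m ω)
        (fun m b => X.fading n m b ω) (fun b => X.noise n b ω) (X.phase n ω)) := rfl

/-- The score added to the power of a device after round `n`. -/
noncomputable def score (sch : Scheme Z K q d A S) (X : Inputs Ω Z K q d A S) (n : ℕ) (ω : Ω) (m : Fin K) : ℝ :=
  match sch.timing with
  | .sameRound => agreement (votes sch (model sch X (n + 1) ω) fun m => X.batch (n + 1) m ω) m
  | .previousRound => agreement (votes sch (model sch X n ω) fun m => X.batch n m ω) m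

lemma power_succ (sch : Scheme Z K q d A S) (X : Inputs Ω Z K q d A S) (n : ℕ) (ω : Ω)
    (m : Fin K) : power sch X (n + 1) ω m = power sch X n ω m + score sch X n ω m := by
  unfold score
  cases h : sch.timing <;> simp only [power, state, model, h]

/-- Scores are absolute values, so powers never fall below their initial value. This sure bound is
what lets the power level enter pointwise. -/
lemma one_le_power (sch : Scheme Z K q d A S) (X : Inputs Ω Z K q d A S) (n : ℕ) (ω : Ω)
    (m : Fin K) : 1 ≤ power sch X n ω m := by
  induction n with
  | zero => exact le_rfl
  | succ n ih =>
    rw [power_succ]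
    have : 0 ≤ score sch X n ω m := by
      unfold score
      split <;> exact abs_nonneg _
    linarith

/-- Each coordinate of an update is `-1`, `0` or `1` times the step size. Finiteness makes every
function of the model simple, hence integrable, and replaces disintegration by a finite sum over
events. -/
lemma finite_range_model (sch : Scheme Z K q d A S) (X : Inputs Ω Z K q d A S) (n : ℕ) :
    (Set.range (model sch X n)).Finite := by
  induction n with
  | zero => exact (Set.finite_singleton sch.init).subset (Set.range_subset_iff.2 fun _ => rfl)
  | succ n ih =>
    have hV : (Set.pi Set.univ fun _ : Fin q => ({-1, 0, 1} : Set ℝ)).Finite :=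
      Set.Finite.pi fun _ => Set.toFinite _
    refine (Set.Finite.image2 (fun w v => w - sch.stepSize • WithLp.toLp 2 v) ih hV).subset ?_
    rintro _ ⟨ω, rfl⟩
    rw [model_succ]
    refine Set.mem_image2_of_mem ⟨ω, rfl⟩ fun i _ => ?_
    rw [Set.mem_insert_iff, Set.mem_insert_iff, Set.mem_singleton_iff]
    exact Real.sign_apply_eq _

section Gradients

variable [MeasurableSpace Z]

lemma measurable_batchGrad (sch : Scheme Z K q d A S)
    (hgrad : Measurable (fun p : Model q × Z => gradient (fun w => sch.loss w p.2) p.1)) :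
    Measurable (fun p : Model q × (Fin d → Z) => batchGrad sch p.1 p.2) := by
  have h : ∀ l : Fin d, Measurable (fun p : Model q × (Fin d → Z) =>
      gradient (fun w => sch.loss w (p.2 l)) p.1) := fun l =>
    hgrad.comp (measurable_fst.prodMk ((measurable_pi_apply l).comp measurable_snd))
  have h2 : Measurable (fun p : Model q × (Fin d → Z) =>
      ∑ l, gradient (fun w => sch.loss w (p.2 l)) p.1) :=
    Finset.measurable_sum Finset.univ fun l _ => h l
  exact h2.const_smul (1 / (d : ℝ))

lemma measurable_votes (sch : Scheme Z K q d A S)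
    (hgrad : Measurable (fun p : Model q × Z => gradient (fun w => sch.loss w p.2) p.1)) :
    Measurable (fun p : Model q × (Fin K → Fin d → Z) => votes sch p.1 p.2) := by
  refine measurable_pi_lambda _ fun m => measurable_pi_lambda _ fun i => ?_
  have h : Measurable (fun w : Model q => w i) := (EuclideanSpace.proj (𝕜 := ℝ) i).measurable
  have h1 : Measurable (fun p : Model q × (Fin K → Fin d → Z) => (p.1, p.2 m)) :=
    measurable_fst.prodMk ((measurable_pi_apply m).comp measurable_snd)
  have h2 : Measurable (fun p : Model q × (Fin K → Fin d → Z) => batchGrad sch p.1 (p.2 m)) := by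
    have := (measurable_batchGrad sch hgrad).comp h1
    exact this
  have h3 := measurable_sign.comp (h.comp h2)
  exact h3

section Step

variable [MeasurableSpace Ω] {sch : Scheme Z K q d A S} {X : Inputs Ω Z K q d A S} {n : ℕ}

lemma measurable_votes_model
    (hgrad : Measurable (fun p : Model q × Z => gradient (fun w => sch.loss w p.2) p.1))
    (hw : Measurable (model sch X n)) (hb : ∀ m, Measurable (X.batch n m)) :
    Measurable (fun ω => votes sch (model sch X n ω) fun m => X.batch n m ω) := by
  have h1 : Measurable fun ω => (model sch X n ω, fun m => X.batch n m ω) :=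
    hw.prodMk (measurable_pi_lambda _ hb)
  have h2 := (measurable_votes sch hgrad).comp h1
  exact h2

lemma measurable_coordVotes
    (hgrad : Measurable (fun p : Model q × Z => gradient (fun w => sch.loss w p.2) p.1))
    (hw : Measurable (model sch X n)) (hb : ∀ m, Measurable (X.batch n m)) (i : Fin q) :
    Measurable (coordVotes sch X n i) := by
  refine measurable_pi_lambda _ fun m => ?_
  have h1 := measurable_votes_model hgrad hw hb
  have h2 : Measurable fun g : Fin K → Fin q → ℝ => g m i := by fun_prop
  have h3 := h2.comp h1
  exact h3

lemma measurable_model_succ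
    (hgrad : Measurable (fun p : Model q × Z => gradient (fun w => sch.loss w p.2) p.1))
    (hw : Measurable (model sch X n)) (hP : Measurable (power sch X n))
    (hb : ∀ m, Measurable (X.batch n m)) (hh : ∀ m b, Measurable (X.fading n m b))
    (hz : ∀ b, Measurable (X.noise n b)) (hp : Measurable (X.phase n)) :
    Measurable (model sch X (n + 1)) := by
  have hin : Measurable fun ω => ((power sch X n ω,
      (votes sch (model sch X n ω) fun m => X.batch n m ω), X.phase n ω),
        (fun m b => X.fading n m b ω), (fun b => X.noise n b ω)) :=
    (hP.prodMk ((measurable_votes_model hgrad hw hb).prodMk hp)).prodMk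
        ((measurable_pi_lambda _ fun m => measurable_pi_lambda _ fun b => hh m b).prodMk
          (measurable_pi_lambda _ hz))
  have hv : Measurable fun ω => detect sch (power sch X n ω)
      (votes sch (model sch X n ω) fun m => X.batch n m ω)
        (fun m b => X.fading n m b ω) (fun b => X.noise n b ω) (X.phase n ω) := by
    refine measurable_pi_lambda _ fun i => ?_
    have := (measurable_detect sch i).comp hin
    exact this
  have h := hw.sub (((WithLp.measurable_toLp 2 (Fin q → ℝ)).comp hv).const_smul sch.stepSize)
  exact h

lemma measurable_power_succ
    (hgrad : Measurable (fun p : Model q × Z => gradient (fun w => sch.loss w p.2) p.1))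
    (hw : Measurable (model sch X n)) (hw' : Measurable (model sch X (n + 1)))
    (hP : Measurable (power sch X n))
    (hb : ∀ m, Measurable (X.batch n m)) (hb' : ∀ m, Measurable (X.batch (n + 1) m)) :
    Measurable (power sch X (n + 1)) := by
  refine measurable_pi_lambda _ fun m => ?_
  simp_rw [power_succ]
  refine ((measurable_pi_apply m).comp hP).add ?_
  unfold score
  split
  · have h := (measurable_agreement m).comp (measurable_votes_model hgrad hw' hb')
    exact h
  · have h := (measurable_agreement m).comp (measurable_votes_model hgrad hw hb)
    exact h

end Step

/-- The σ-algebra generated by a set of sources. -/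
noncomputable abbrev Inputs.sigmaOf (X : Inputs Ω Z K q d A S) (T : Set (Source K A S)) : MeasurableSpace Ω :=
  ⨆ s ∈ T, X.sigma s

variable {X : Inputs Ω Z K q d A S} {T : Set (Source K A S)}

lemma measurable_batch_sigmaOf {n : ℕ} {m : Fin K} (h : .batch n m ∈ T) :
    Measurable[X.sigmaOf T] (X.batch n m) :=
  (comap_measurable (X.batch n m)).mono (le_iSup₂_of_le (.batch n m) h le_rfl) le_rfl

lemma measurable_fading_sigmaOf {n : ℕ} {m : Fin K} {b : Fin A × Fin S} (h : .fading n m b ∈ T) :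
    Measurable[X.sigmaOf T] (X.fading n m b) :=
  (comap_measurable (X.fading n m b)).mono (le_iSup₂_of_le (.fading n m b) h le_rfl) le_rfl

lemma measurable_noise_sigmaOf {n : ℕ} {b : Fin A × Fin S} (h : .noise n b ∈ T) :
    Measurable[X.sigmaOf T] (X.noise n b) :=
  (comap_measurable (X.noise n b)).mono (le_iSup₂_of_le (.noise n b) h le_rfl) le_rfl

lemma measurable_phase_sigmaOf {n : ℕ} (h : .phase n ∈ T) :
    Measurable[X.sigmaOf T] (X.phase n) :=
  (comap_measurable (X.phase n)).mono (le_iSup₂_of_le (.phase n) h le_rfl) le_rfl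

lemma past_eq_sigmaOf (n : ℕ) : X.past n = X.sigmaOf {s | s.round < n} := rfl

lemma sigmaOf_mono {T' : Set (Source K A S)} (h : T ⊆ T') : X.sigmaOf T ≤ X.sigmaOf T' :=
  biSup_mono h

/-- The sources known when the votes and powers of round `n` are fixed. -/
def decided (K A S : ℕ) (n : ℕ) : Set (Source K A S) :=
  {s | s.round < n ∨ ∃ m, s = .batch n m}

/-- The two σ-algebras differ because, with same-round timing, the power already depends on the
batches of the current round; the model depends on the past alone. In the induction the next model
has to come before the next power. -/
lemma measurable_model_power {sch : Scheme Z K q d A S}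
    (hgrad : Measurable (fun p : Model q × Z => gradient (fun w => sch.loss w p.2) p.1)) (n : ℕ) :
    Measurable[X.past n] (model sch X n) ∧
      Measurable[X.sigmaOf (decided K A S n)] (power sch X n) := by
  induction n with
  | zero => exact ⟨@measurable_const _ _ _ (_) _, @measurable_const _ _ _ (_) _⟩
  | succ n ih =>
    have hdp : X.sigmaOf (decided K A S n) ≤ X.past (n + 1) := by
      rw [past_eq_sigmaOf]
      refine sigmaOf_mono ?_
      rintro s (h | ⟨m, rfl⟩)
      · exact Nat.lt_succ_of_lt h
      · exact Nat.lt_succ_self n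
    have hpd : X.past (n + 1) ≤ X.sigmaOf (decided K A S (n + 1)) := by
      rw [past_eq_sigmaOf]
      exact sigmaOf_mono fun s h => Or.inl h
    have hpp : X.past n ≤ X.past (n + 1) := by
      rw [past_eq_sigmaOf, past_eq_sigmaOf]
      exact sigmaOf_mono fun s h => Nat.lt_succ_of_lt h
    have hn : n < n + 1 := Nat.lt_succ_self n
    have hw := ih.1.mono hpp le_rfl
    have hP := ih.2.mono hdp le_rfl
    have hb : ∀ m, Measurable[X.past (n + 1)] (X.batch n m) := fun m => by
      rw [past_eq_sigmaOf]; exact measurable_batch_sigmaOf hn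
    have hw' : Measurable[X.past (n + 1)] (model sch X (n + 1)) :=
      @measurable_model_succ Ω Z K q d A S _ (_) sch X n hgrad hw hP hb
        (fun m b => by rw [past_eq_sigmaOf]; exact measurable_fading_sigmaOf hn)
        (fun b => by rw [past_eq_sigmaOf]; exact measurable_noise_sigmaOf hn)
        (by rw [past_eq_sigmaOf]; exact measurable_phase_sigmaOf hn)
    exact ⟨hw', @measurable_power_succ Ω Z K q d A S _ (_) sch X n hgrad
      (hw.mono hpd le_rfl) (hw'.mono hpd le_rfl) (hP.mono hpd le_rfl)
      (fun m => (hb m).mono hpd le_rfl)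
      (fun m => measurable_batch_sigmaOf (Or.inr ⟨m, rfl⟩))⟩

end Gradients

end Measurability

/-- If `Y` and `Z` factorize on the event `E`, the second one having there the law of `Z'`, then
expectations on `E` are iterated expectations. -/
lemma setIntegral_comp_of_factorized {Ω α β : Type*} [MeasurableSpace Ω] [MeasurableSpace α]
    [MeasurableSpace β] {μ : Measure Ω} [IsProbabilityMeasure μ] {E : Set Ω}
    {Y : Ω → α} {Z Z' : Ω → β} (hY : Measurable Y) (hZ : Measurable Z)
    (hZ' : Measurable Z')
    (h : ∀ B C, MeasurableSet B → MeasurableSet C →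
      μ (E ∩ (Y ⁻¹' B ∩ Z ⁻¹' C)) = μ (E ∩ Y ⁻¹' B) * μ (Z' ⁻¹' C))
    {Φ : α × β → ℝ} (hΦ : Measurable Φ) {M : ℝ} (hM : ∀ p, |Φ p| ≤ M) :
    ∫ ω in E, Φ (Y ω, Z ω) ∂μ = ∫ ω in E, ∫ ω', Φ (Y ω, Z' ω') ∂μ ∂μ := by
  have : IsProbabilityMeasure (μ.map Z') := Measure.isProbabilityMeasure_map hZ'.aemeasurable
  have hprod : (μ.restrict E).map (fun ω => (Y ω, Z ω)) =
      ((μ.restrict E).map Y).prod (μ.map Z') := by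
    refine (Measure.prod_eq fun B C hB hC => ?_).symm
    rw [Measure.map_apply (hY.prodMk hZ) (hB.prod hC), Measure.map_apply hY hB,
      Measure.map_apply hZ' hC, Measure.restrict_apply ((hY.prodMk hZ) (hB.prod hC)),
      Measure.restrict_apply (hY hB), Set.inter_comm _ E, Set.inter_comm _ E, ← h B C hB hC]
    rfl
  rw [← integral_map (φ := fun ω => (Y ω, Z ω)) (hY.prodMk hZ).aemeasurable
    hΦ.aestronglyMeasurable, hprod, integral_prod _ (Integrable.of_bound
    hΦ.aestronglyMeasurable M (ae_of_all _ hM)), integral_map hY.aemeasurable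
    hΦ.stronglyMeasurable.integral_prod_right'.aestronglyMeasurable]
  congr 1 with ω
  have hω : Measurable fun z => Φ (Y ω, z) := hΦ.comp measurable_prodMk_left
  rw [integral_map hZ'.aemeasurable hω.aestronglyMeasurable]

/-! ### The channel: law of the received symbols and mean decision. -/

section Sources

variable {Ω Z : Type*} [MeasurableSpace Z] {K q d A S : ℕ} {sch : Scheme Z K q d A S}
  {X : Inputs Ω Z K q d A S} {σn : ℝ≥0}

/-- Sources feeding the bin `b` in round `n`. -/
def binSources (K : ℕ) {A S : ℕ} (n : ℕ) (b : Fin A × Fin S) : Set (Source K A S) :=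
  {s | s = .noise n b ∨ ∃ m, s = .fading n m b}

lemma measurable_rxSymbol_sigmaOf (P : Fin K → ℝ) (g : Fin K → Fin q → ℝ) (ph : Fin K → Fin q → ℂ)
    (n : ℕ) (i : Fin q) (s : Bool) : Measurable[X.sigmaOf (binSources K n (sch.slot (i, s)))]
      (fun ω => rxSymbol sch P g (fun m b => X.fading n m b ω) (fun b => X.noise n b ω) ph i s) := by
  unfold rxSymbol
  refine @Measurable.add _ _ _ _ _ (_) _ _ ?_ (measurable_noise_sigmaOf (Or.inl rfl))
  refine @Finset.measurable_sum _ _ _ _ _ _ (_) _ _ fun m _ => ?_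
  refine @Measurable.mul_const _ _ _ _ _ (_) _ ?_ _
  exact @Measurable.const_mul _ _ _ _ _ (_) _ (measurable_fading_sigmaOf (Or.inr ⟨m, rfl⟩)) _

/-- Mean received energy on the `s`-bin of a coordinate with votes `V`. -/
noncomputable def meanEnergy (E₀ : ℝ) (σn : ℝ≥0) (P V : Fin K → ℝ) (s : Bool) : ℝ :=
  E₀ * ∑ m, (if V m = voteValue s then P m else 0) + (σn : ℝ) ^ 2

lemma meanEnergy_pos {E₀ : ℝ} (hE : 0 < E₀) (hσn : 0 < σn) {P : Fin K → ℝ} (hP : ∀ m, 0 ≤ P m)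
    (V : Fin K → ℝ) (s : Bool) : 0 < meanEnergy E₀ σn P V s := by
  have h : 0 ≤ ∑ m, (if V m = voteValue s then P m else 0) :=
    Finset.sum_nonneg fun m _ => by split_ifs <;> simp [hP m]
  have h2 : (0 : ℝ) < σn := hσn
  unfold meanEnergy
  positivity

variable [MeasurableSpace Ω] {μ : Measure Ω}

lemma IsRayleighModel.sigma_le (hX : IsRayleighModel X σn μ) (s : Source K A S) :
    X.sigma s ≤ ‹MeasurableSpace Ω› := by
  cases s with
  | batch n m => exact (hX.measurable_batch n m).comap_le
  | fading n m b => exact (hX.measurable_fading n m b).comap_le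
  | noise n b => exact (hX.measurable_noise n b).comap_le
  | phase n => exact (hX.measurable_phase n).comap_le

lemma IsRayleighModel.sigmaOf_le (hX : IsRayleighModel X σn μ) (T : Set (Source K A S)) :
    X.sigmaOf T ≤ ‹MeasurableSpace Ω› :=
  iSup₂_le fun s _ => hX.sigma_le s

lemma IsRayleighModel.indep_sigmaOf (hX : IsRayleighModel X σn μ) {T T' : Set (Source K A S)}
    (h : Disjoint T T') : Indep (X.sigmaOf T) (X.sigmaOf T') μ :=
  indep_iSup_of_disjoint hX.sigma_le hX.indep h

/-- For frozen powers, votes and phases the two symbols draw on disjoint sets of sources, because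
`slot` is injective. -/
lemma indepFun_rxSymbol (hX : IsRayleighModel X σn μ) (P : Fin K → ℝ) (g : Fin K → Fin q → ℝ)
    (ph : Fin K → Fin q → ℂ) (n : ℕ) (i : Fin q) :
    IndepFun (fun ω => rxSymbol sch P g (fun m b => X.fading n m b ω)
        (fun b => X.noise n b ω) ph i true)
      (fun ω => rxSymbol sch P g (fun m b => X.fading n m b ω)
        (fun b => X.noise n b ω) ph i false) μ := by
  rw [IndepFun_iff_Indep]
  refine indep_of_indep_of_le_left (indep_of_indep_of_le_right (hX.indep_sigmaOf ?_)
    (measurable_rxSymbol_sigmaOf P g ph n i false).comap_le)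
    (measurable_rxSymbol_sigmaOf P g ph n i true).comap_le
  have hne : sch.slot (i, true) ≠ sch.slot (i, false) := fun h => by
    simpa using sch.slot.injective h
  rw [Set.disjoint_left]
  rintro s (rfl | ⟨m, rfl⟩) (h | ⟨m', h⟩)
  · exact hne (Source.noise.inj h).2
  · cases h
  · cases h
  · exact hne (Source.fading.inj h).2.2

variable [IsProbabilityMeasure μ]

/-- The symbol is a linear combination of independent circular Gaussians. The unit-modulus phases
drop out of the variance. -/
lemma map_rxSymbol (hX : IsRayleighModel X σn μ) (hE : 0 < sch.symbolEnergy)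
    (hσn : 0 < σn) {P : Fin K → ℝ} (hP : ∀ m, 0 ≤ P m) (g : Fin K → Fin q → ℝ) {ph : Fin K → Fin q → ℂ}
    (hph : ∀ m i, ‖ph m i‖ = 1) (n : ℕ) (i : Fin q) (s : Bool) :
    μ.map (fun ω => rxSymbol sch P g (fun m b => X.fading n m b ω)
        (fun b => X.noise n b ω) ph i s) =
      complexGaussian (meanEnergy sch.symbolEnergy σn P (fun m => g m i) s).toNNReal := by
  set b := sch.slot (i, s)
  -- `none` stands for the receiver noise and `some m` for the channel of device `m`.
  let src : Option (Fin K) → Source K A S := fun o => o.elim (.noise n b) fun m => .fading n m b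
  have hsrc : Function.Injective src := by
    rintro (_ | m) (_ | m') h <;> simp_all [src]
  let Y : Option (Fin K) → Ω → ℂ := fun o => o.elim (X.noise n b) fun m => X.fading n m b
  have hY : iIndepFun Y μ := by
    have h := hX.indep.precomp hsrc
    refine (iIndepFun_iff_iIndep ..).2 ?_
    convert h using 1
    funext o
    cases o <;> rfl
  have hYm : ∀ o, Measurable (Y o) := by
    rintro (_ | m)
    · exact hX.measurable_noise n b
    · exact hX.measurable_fading n m b
  have hlaw : ∀ o, μ.map (Y o) = complexGaussian (o.elim (σn ^ 2) fun _ => 1) := by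
    rintro (_ | m)
    · exact hX.law_noise n b
    · exact hX.law_fading n m b
  have h := map_sum_mul_complexGaussian hYm hY hlaw
    (fun o => o.elim 1 fun m => (Real.sqrt (P m) : ℂ) * txSymbol sch.symbolEnergy ph g m i s)
  rw [show (fun ω => rxSymbol sch P g (fun m b => X.fading n m b ω)
      (fun b => X.noise n b ω) ph i s) = fun ω => ∑ o : Option (Fin K),
      (o.elim 1 fun m => (Real.sqrt (P m) : ℂ) * txSymbol sch.symbolEnergy ph g m i s) * Y o ω from ?_,
    h]
  · congr 1
    ext
    rw [Real.coe_toNNReal _ (meanEnergy_pos hE hσn hP _ _).le, Fintype.sum_option]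
    simp only [Option.elim, nnnorm_one, one_pow, one_mul, mul_one, NNReal.coe_add, NNReal.coe_pow,
      NNReal.coe_sum, coe_nnnorm, norm_mul, mul_pow, meanEnergy, txSymbol]
    rw [add_comm, Finset.mul_sum]
    congr 1
    refine Finset.sum_congr rfl fun m _ => ?_
    rw [Complex.norm_real, Real.norm_eq_abs, sq_abs, Real.sq_sqrt (hP m)]
    split_ifs
    · rw [norm_mul, hph, mul_one, Complex.norm_real, Real.norm_eq_abs, sq_abs, Real.sq_sqrt hE.le,
        mul_comm]
    · simp
  · funext ω
    rw [Fintype.sum_option]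
    simp only [rxSymbol, Option.elim, Y, one_mul]
    rw [add_comm]
    congr 1
    exact Finset.sum_congr rfl fun m _ => by ring

/-- Mean decision of the energy detector given the powers `P` and the votes `V`. -/
noncomputable def meanDecision (E₀ : ℝ) (σn : ℝ≥0) (P V : Fin K → ℝ) : ℝ :=
  (meanEnergy E₀ σn P V true - meanEnergy E₀ σn P V false) /
    (meanEnergy E₀ σn P V true + meanEnergy E₀ σn P V false)

lemma integral_detect (hX : IsRayleighModel X σn μ) (hE : 0 < sch.symbolEnergy)
    (hσn : 0 < σn) {P : Fin K → ℝ} (hP : ∀ m, 0 ≤ P m) (g : Fin K → Fin q → ℝ)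
    {ph : Fin K → Fin q → ℂ} (hph : ∀ m i, ‖ph m i‖ = 1) (n : ℕ) (i : Fin q) :
    ∫ ω, detect sch P g (fun m b => X.fading n m b ω) (fun b => X.noise n b ω) ph i ∂μ =
      meanDecision sch.symbolEnergy σn P fun m => g m i := by
  have hm : ∀ s, Measurable (fun ω => rxSymbol sch P g (fun m b => X.fading n m b ω)
      (fun b => X.noise n b ω) ph i s) := fun s =>
    (measurable_rxSymbol_sigmaOf P g ph n i s).mono (hX.sigmaOf_le _) le_rfl
  have hpair := (indepFun_iff_map_prod_eq_prod_map_map (hm true).aemeasurable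
    (hm false).aemeasurable).1 (indepFun_rxSymbol (sch := sch) hX P g ph n i)
  rw [map_rxSymbol hX hE hσn hP g hph, map_rxSymbol hX hE hσn hP g hph] at hpair
  have hpos := meanEnergy_pos hE hσn hP (fun m => g m i)
  have h := integral_sign_energy (Real.toNNReal_pos.2 (hpos true)) (Real.toNNReal_pos.2 (hpos false))
  have hsign : Measurable fun p : ℂ × ℂ => Real.sign (‖p.1‖ ^ 2 - ‖p.2‖ ^ 2) :=
    measurable_sign.comp (by fun_prop)
  rw [← hpair, integral_map ((hm true).prodMk (hm false)).aemeasurable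
    hsign.aestronglyMeasurable,
    Real.coe_toNNReal _ (hpos true).le, Real.coe_toNNReal _ (hpos false).le] at h
  exact h

lemma abs_meanDecision_le_one {E₀ : ℝ} (hE : 0 < E₀) (hσn : 0 < σn) {P : Fin K → ℝ}
    (hP : ∀ m, 0 ≤ P m) (V : Fin K → ℝ) : |meanDecision E₀ σn P V| ≤ 1 := by
  have h1 := meanEnergy_pos hE hσn hP V true
  have h2 := meanEnergy_pos hE hσn hP V false
  rw [meanDecision, abs_div, abs_of_pos (add_pos h1 h2), div_le_one (add_pos h1 h2), abs_le]
  constructor <;> linarith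

lemma measurable_meanDecision (E₀ : ℝ) (σn : ℝ≥0) :
    Measurable (fun p : (Fin K → ℝ) × (Fin K → ℝ) => meanDecision E₀ σn p.1 p.2) := by
  have h : ∀ s, Measurable (fun p : (Fin K → ℝ) × (Fin K → ℝ) => meanEnergy E₀ σn p.1 p.2 s) :=
    fun s => ((Finset.measurable_sum _ fun m _ => Measurable.ite
      (measurableSet_eq_fun (by fun_prop) measurable_const) (by fun_prop)
      measurable_const).const_mul _).add_const _
  exact ((h true).sub (h false)).div ((h true).add (h false))

/-- If no device abstains, the mean decision is a weighted average of the votes. -/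
lemma meanDecision_eq_sum {E₀ : ℝ} {P V : Fin K → ℝ} (hV : ∀ m, V m = 1 ∨ V m = -1) :
    meanDecision E₀ σn P V =
      ∑ m, E₀ * P m / (E₀ * ∑ m, P m + 2 * (σn : ℝ) ^ 2) * V m := by
  have h1 : meanEnergy E₀ σn P V true - meanEnergy E₀ σn P V false = ∑ m, E₀ * P m * V m := by
    simp only [meanEnergy, voteValue]
    rw [add_sub_add_right_eq_sub, ← mul_sub, ← Finset.sum_sub_distrib, Finset.mul_sum]
    refine Finset.sum_congr rfl fun m _ => ?_
    rcases hV m with h | h <;> rw [h] <;> norm_num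
  have h2 : meanEnergy E₀ σn P V true + meanEnergy E₀ σn P V false =
      E₀ * ∑ m, P m + 2 * (σn : ℝ) ^ 2 := by
    simp only [meanEnergy, voteValue]
    rw [add_add_add_comm, ← mul_add, ← Finset.sum_add_distrib, ← two_mul]
    congr 2
    refine Finset.sum_congr rfl fun m _ => ?_
    rcases hV m with h | h <;> rw [h] <;> norm_num
  rw [meanDecision, h1, h2, Finset.sum_div]
  exact Finset.sum_congr rfl fun m _ => by ring

end Sources

/-! ### One round: averaging over the channel, then over the votes. -/

section Round

variable {Ω Z : Type*} [MeasurableSpace Z] {K q d A S : ℕ} {sch : Scheme Z K q d A S}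
  {X : Inputs Ω Z K q d A S} {σn : ℝ≥0}

/-- The votes on coordinate `i` if the model of round `n` is `w`. -/
noncomputable def votesAt (sch : Scheme Z K q d A S) (X : Inputs Ω Z K q d A S) (n : ℕ) (i : Fin q)
    (w : Model q) (ω : Ω) : Fin K → ℝ :=
  fun m => votes sch w (fun m' => X.batch n m' ω) m i

lemma measurable_votesAt (sch : Scheme Z K q d A S) {T : Set (Source K A S)} {n : ℕ}
    (hT : ∀ m, .batch n m ∈ T)
    (hgrad : Measurable (fun p : Model q × Z => gradient (fun w => sch.loss w p.2) p.1))
    (i : Fin q) (w : Model q) : Measurable[X.sigmaOf T] (votesAt sch X n i w) := by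
  have hb : Measurable[X.sigmaOf T] fun ω m => X.batch n m ω :=
    @measurable_pi_lambda _ _ _ (X.sigmaOf T) _ _ fun m => measurable_batch_sigmaOf (hT m)
  have h : Measurable fun b : Fin K → Fin d → Z => fun m => votes sch w b m i := by
    have h1 : Measurable fun b : Fin K → Fin d → Z => votes sch w b := by
      have h0 := (measurable_votes (K := K) sch hgrad).comp (measurable_prodMk_left (x := w))
      exact h0
    refine measurable_pi_lambda _ fun m => ?_
    have h2 : Measurable fun g : Fin K → Fin q → ℝ => g m i := by fun_prop
    have h3 := h2.comp h1
    exact h3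
  have h4 := h.comp hb
  exact h4

lemma measurableSet_model_eq
    (hgrad : Measurable (fun p : Model q × Z => gradient (fun w => sch.loss w p.2) p.1)) (n : ℕ)
    (w : Model q) : MeasurableSet[X.past n] (model sch X n ⁻¹' {w}) :=
  (measurable_model_power hgrad n).1 (measurableSet_singleton w)

variable [MeasurableSpace Ω] {μ : Measure Ω} [IsProbabilityMeasure μ]

/-- The decisions of the detector in round `n`. -/
noncomputable def decision (sch : Scheme Z K q d A S) (X : Inputs Ω Z K q d A S) (n : ℕ) (ω : Ω) :
    Fin q → ℝ :=
  detect sch (power sch X n ω) (votes sch (model sch X n ω) fun m => X.batch n m ω)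
    (fun m b => X.fading n m b ω) (fun b => X.noise n b ω) (X.phase n ω)

/-- Fading and noise of round `n` are independent of the past, the current batches and the phases
together, so powers, votes and phases can be frozen while the channel is integrated out. -/
lemma setIntegral_decision (hX : IsRayleighModel X σn μ)
    (hgrad : Measurable (fun p : Model q × Z => gradient (fun w => sch.loss w p.2) p.1))
    (hE : 0 < sch.symbolEnergy) (hσn : 0 < σn) {n : ℕ} (i : Fin q) {E : Set Ω}
    (hEm : MeasurableSet[X.past n] E) :
    ∫ ω in E, decision sch X n ω i ∂μ = ∫ ω in E,
      meanDecision sch.symbolEnergy σn (power sch X n ω) (coordVotes sch X n i ω) ∂μ := by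
  let T : Set (Source K A S) := {s | s ∈ decided K A S n ∨ s = .phase n}
  let T' : Set (Source K A S) := {s | ∃ b, s ∈ binSources K n b}
  have hTT' : Disjoint T T' := by
    rw [Set.disjoint_left]
    rintro s ((h | ⟨m, rfl⟩) | rfl) ⟨b, hb | ⟨m', hb⟩⟩
    · rw [hb] at h; exact lt_irrefl _ h
    · rw [hb] at h; exact lt_irrefl _ h
    all_goals cases hb
  have hdT : X.sigmaOf (decided K A S n) ≤ X.sigmaOf T := sigmaOf_mono fun s h => Or.inl h
  have hpT : X.past n ≤ X.sigmaOf T := by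
    rw [past_eq_sigmaOf]
    exact sigmaOf_mono fun s h => Or.inl (Or.inl h)
  have hw := (measurable_model_power (X := X) (sch := sch) hgrad n).1.mono hpT le_rfl
  have hP := (measurable_model_power (X := X) (sch := sch) hgrad n).2.mono hdT le_rfl
  have hV := @measurable_votes_model Ω Z K q d A S _ (X.sigmaOf T) sch X n hgrad hw
    fun m => measurable_batch_sigmaOf (Or.inl (Or.inr ⟨m, rfl⟩))
  have hph : Measurable[X.sigmaOf T] (X.phase n) := measurable_phase_sigmaOf (Or.inr rfl)
  let Y : Ω → (Fin K → ℝ) × (Fin K → Fin q → ℝ) × (Fin K → Fin q → ℂ) := fun ω =>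
    (power sch X n ω, votes sch (model sch X n ω) (fun m => X.batch n m ω), X.phase n ω)
  let C : Ω → (Fin K → Fin A × Fin S → ℂ) × (Fin A × Fin S → ℂ) := fun ω =>
    (fun m b => X.fading n m b ω, fun b => X.noise n b ω)
  have hY : Measurable[X.sigmaOf T] Y :=
    hP.prodMk (hV.prodMk hph)
  have hC : Measurable[X.sigmaOf T'] C :=
    Measurable.prodMk (@measurable_pi_lambda _ _ _ (X.sigmaOf T') _ _ fun m =>
        @measurable_pi_lambda _ _ _ (X.sigmaOf T') _ _ fun b =>
          measurable_fading_sigmaOf ⟨b, Or.inr ⟨m, rfl⟩⟩)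
      (@measurable_pi_lambda _ _ _ (X.sigmaOf T') _ _ fun b =>
        measurable_noise_sigmaOf ⟨b, Or.inl rfl⟩)
  have hind := (Indep_iff _ _ _).1 (hX.indep_sigmaOf hTT')
  have hfac := setIntegral_comp_of_factorized (μ := μ) (E := E)
    (hY.mono (hX.sigmaOf_le _) le_rfl) (hC.mono (hX.sigmaOf_le _) le_rfl)
    (hC.mono (hX.sigmaOf_le _) le_rfl) (fun B D hB hD => by
      rw [← Set.inter_assoc]
      exact hind _ _ (@MeasurableSet.inter _ (X.sigmaOf T) _ _ (hpT _ hEm) (hY hB)) (hC hD))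
    (measurable_detect sch i) (M := 1) fun p => abs_sign_le_one _
  have hl : ∫ ω in E, decision sch X n ω i ∂μ = ∫ ω in E,
    (fun p : ((Fin K → ℝ) × (Fin K → Fin q → ℝ) × (Fin K → Fin q → ℂ)) ×
        (Fin K → Fin A × Fin S → ℂ) × (Fin A × Fin S → ℂ) =>
      detect sch p.1.1 p.1.2.1 p.2.1 p.2.2 p.1.2.2 i) (Y ω, C ω) ∂μ := rfl
  rw [hl, hfac]
  have hunit : ∀ᵐ ω ∂μ, ∀ m i, ‖X.phase n ω m i‖ = 1 :=
    ae_all_iff.2 fun m => ae_all_iff.2 fun i => hX.phase_unit n m i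
  refine integral_congr_ae (ae_restrict_of_ae ?_)
  filter_upwards [hunit] with ω hω
  exact integral_detect hX hE hσn (fun m => zero_le_one.trans (one_le_power sch X n ω m))
    (votes sch (model sch X n ω) fun m => X.batch n m ω) hω n i

/-- On the event that the model of round `n` is `w`, powers and votes factorize. -/
lemma measure_power_votes_inter (hX : IsRayleighModel X σn μ)
    (hgrad : Measurable (fun p : Model q × Z => gradient (fun w => sch.loss w p.2) p.1))
    {n : ℕ} {i : Fin q} (hdec : PowerVoteDecoupled sch X μ n i) (w : Model q)
    {B C : Set (Fin K → ℝ)} (hB : MeasurableSet B) (hC : MeasurableSet C) :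
    μ (model sch X n ⁻¹' {w} ∩ (power sch X n ⁻¹' B ∩ coordVotes sch X n i ⁻¹' C)) =
      μ (model sch X n ⁻¹' {w} ∩ power sch X n ⁻¹' B) * μ (votesAt sch X n i w ⁻¹' C) := by
  set E := model sch X n ⁻¹' {w}
  have hpast : X.past n ≤ ‹MeasurableSpace Ω› := by
    rw [past_eq_sigmaOf]; exact hX.sigmaOf_le _
  have hE : MeasurableSet[X.past n] E := measurableSet_model_eq hgrad n w
  have hPm : MeasurableSet (power sch X n ⁻¹' B) :=
    hX.sigmaOf_le _ _ ((measurable_model_power hgrad n).2 hB)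
  have hVm : MeasurableSet (coordVotes sch X n i ⁻¹' C) :=
    measurable_coordVotes hgrad ((measurable_model_power hgrad n).1.mono hpast le_rfl)
      (hX.measurable_batch n) i hC
  let T : Set (Source K A S) := {s | ∃ m, s = .batch n m}
  have hWm : MeasurableSet[X.sigmaOf T] (votesAt sch X n i w ⁻¹' C) :=
    measurable_votesAt sch (T := T) (fun m => ⟨m, rfl⟩) hgrad i w hC
  have hWm' := hX.sigmaOf_le _ _ hWm
  have hone : ∀ {s : Set Ω}, MeasurableSet s → Integrable (s.indicator fun _ => (1 : ℝ)) μ :=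
    fun hs => (integrable_const _).indicator hs
  have hset : ∀ {s : Set Ω}, MeasurableSet s →
      ∫ ω in E, (μ⟦s | X.past n⟧) ω ∂μ = μ.real (E ∩ s) := fun {s} hs => by
    rw [setIntegral_condExp hpast (hone hs) hE, setIntegral_indicator hs]
    simp
  -- At a frozen model the votes are functions of the fresh batches, hence independent of the past.
  have hindep : μ⟦votesAt sch X n i w ⁻¹' C | X.past n⟧ =ᵐ[μ]
      fun _ => μ.real (votesAt sch X n i w ⁻¹' C) := by
    have hdisj : Disjoint T {s | s.round < n} := by
      rw [Set.disjoint_left]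
      rintro _ ⟨m, rfl⟩ h
      exact lt_irrefl n h
    have hsm : StronglyMeasurable[X.sigmaOf T]
        ((votesAt sch X n i w ⁻¹' C).indicator fun _ => (1 : ℝ)) :=
      (@stronglyMeasurable_const _ _ (X.sigmaOf T) _ _).indicator hWm
    have h := condExp_indep_eq (hX.sigmaOf_le _) hpast hsm
      (hX.indep_sigmaOf hdisj)
    refine h.trans (ae_of_all _ fun _ => ?_)
    simp [integral_indicator_const _ hWm']
  -- On `E` the actual votes are those at the frozen model, and `E` belongs to the past, so the
  -- conditional vote probability is constant there.
  have hcond : ∀ᵐ ω ∂μ, ω ∈ E → (μ⟦coordVotes sch X n i ⁻¹' C | X.past n⟧) ω =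
      μ.real (votesAt sch X n i w ⁻¹' C) := by
    have heq : E.indicator ((coordVotes sch X n i ⁻¹' C).indicator fun _ => (1 : ℝ)) =
        E.indicator ((votesAt sch X n i w ⁻¹' C).indicator fun _ => (1 : ℝ)) := by
      refine Set.indicator_congr fun ω hω => ?_
      have hω' : model sch X n ω = w := hω
      have : coordVotes sch X n i ω = votesAt sch X n i w ω := by
        unfold coordVotes votesAt
        rw [hω']
      by_cases h : votesAt sch X n i w ω ∈ C
      · rw [Set.indicator_of_mem (Set.mem_preimage.2 h),
          Set.indicator_of_mem (Set.mem_preimage.2 (this ▸ h))]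
      · rw [Set.indicator_of_notMem (fun h' => h (Set.mem_preimage.1 h')),
          Set.indicator_of_notMem fun h' => h (this ▸ Set.mem_preimage.1 h')]
    have h1 := condExp_indicator (hone hVm) hE
    have h2 := condExp_indicator (hone hWm') hE
    rw [heq] at h1
    filter_upwards [h1, h2, hindep] with ω e1 e2 e3 hω
    rw [e1, Set.indicator_of_mem hω, Set.indicator_of_mem hω, e3] at e2
    exact e2
  -- Integrating the conditional factorization over `E` pulls this constant out.
  have hreal : μ.real (E ∩ (power sch X n ⁻¹' B ∩ coordVotes sch X n i ⁻¹' C)) =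
      μ.real (E ∩ power sch X n ⁻¹' B) * μ.real (votesAt sch X n i w ⁻¹' C) := by
    rw [← hset (hPm.inter hVm), ← hset hPm, ← integral_mul_const]
    refine setIntegral_congr_ae (hpast _ hE) ?_
    filter_upwards [hdec B C hB hC, hcond] with ω e1 e2 hω
    rw [e1, e2 hω]
  rw [← ofReal_measureReal, hreal, ENNReal.ofReal_mul measureReal_nonneg, ofReal_measureReal,
    ofReal_measureReal]

/-- A single device votes on average for the sign of the gradient, up to the standard deviation. -/
lemma vote_margin (hX : IsRayleighModel X σn μ)
    (hgrad : Measurable (fun p : Model q × Z => gradient (fun w => sch.loss w p.2) p.1))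
    {D : Measure Z} {σ : Fin q → ℝ} (hσ : ∀ i, 0 ≤ σ i)
    (hvar : UnbiasedBoundedVariance sch X μ D σ) (hnoise : UnimodalSymmetricNoise sch X μ)
    {w : Model q} (n : ℕ) (m : Fin K) {i : Fin q} (hg : gradient (globalLoss sch D) w i ≠ 0) :
    (∀ᵐ ω ∂μ, votesAt sch X n i w ω m = 1 ∨ votesAt sch X n i w ω m = -1) ∧
    0 ≤ ∫ ω, Real.sign (gradient (globalLoss sch D) w i) * votesAt sch X n i w ω m ∂μ ∧
    |gradient (globalLoss sch D) w i| - Real.sqrt 3 / 4 * (σ i / Real.sqrt d) ≤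
      |gradient (globalLoss sch D) w i| *
        ∫ ω, Real.sign (gradient (globalLoss sch D) w i) * votesAt sch X n i w ω m ∂μ := by
  set c := gradient (globalLoss sch D) w i
  obtain ⟨hL2, hmean, hv⟩ := hvar w n m i
  obtain ⟨hu, hs⟩ := hnoise w n m i
  set Y : Ω → ℝ := fun ω => batchGrad sch w (X.batch n m ω) i
  have hYm : Measurable Y := by
    have h1 : Measurable (fun b : Fin d → Z => batchGrad sch w b) := by
      have h0 := (measurable_batchGrad sch hgrad).comp (measurable_prodMk_left (x := w))
      exact h0
    have h : Measurable (fun w : Model q => w i) := (EuclideanSpace.proj (𝕜 := ℝ) i).measurable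
    have h2 := (h.comp h1).comp (hX.measurable_batch n m)
    exact h2
  have hprob : IsProbabilityMeasure (μ.map Y) := Measure.isProbabilityMeasure_map hYm.aemeasurable
  have hmean' : ∫ y, y ∂(μ.map Y) = c := by
    rw [integral_map hYm.aemeasurable (by fun_prop)]
    exact hmean
  have hs' : (μ.map Y).map (fun x => 2 * c - x) = μ.map Y := by
    rw [← hmean']
    exact hs
  have hsq : Measurable fun x : ℝ => (x - c) ^ 2 := by fun_prop
  have hint : Integrable (fun x => (x - c) ^ 2) (μ.map Y) := by
    rw [integrable_map_measure hsq.aestronglyMeasurable hYm.aemeasurable]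
    exact (hL2.sub (memLp_const c)).integrable_sq
  have hvar' : ∫ x, (x - c) ^ 2 ∂(μ.map Y) ≤ (σ i / Real.sqrt d) ^ 2 := by
    rw [integral_map hYm.aemeasurable hsq.aestronglyMeasurable, div_pow,
      Real.sq_sqrt (Nat.cast_nonneg d)]
    exact hv
  have hsignm : Measurable fun x => Real.sign c * Real.sign x := measurable_sign.const_mul _
  have e : ∫ ω, Real.sign c * votesAt sch X n i w ω m ∂μ =
      ∫ x, Real.sign c * Real.sign x ∂(μ.map Y) := by
    rw [integral_map hYm.aemeasurable hsignm.aestronglyMeasurable]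
    rfl
  rw [e]
  refine ⟨?_, integral_sign_nonneg hs' hg,
    abs_mul_integral_sign_ge hu hs' hint (div_nonneg (hσ i) (Real.sqrt_nonneg _)) hvar' hg⟩
  have h0 := measure_singleton_of_unimodal hu hs' (Ne.symm hg)
  rw [map_measureReal_apply hYm (measurableSet_singleton _), measureReal_eq_zero_iff] at h0
  filter_upwards [measure_eq_zero_iff_ae_notMem.1 h0] with ω hω
  have hne : Y ω ≠ 0 := hω
  rcases hne.lt_or_gt with h | h
  · right; exact Real.sign_of_neg h
  · left; exact Real.sign_of_pos h

end Round

/-! ### Expected progress per round. -/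

section Descent

/-- Functions of the model of a round are simple. -/
lemma comp_model_eq_sum {Ω Z : Type*} {K q d A S : ℕ}
    (sch : Scheme Z K q d A S) (X : Inputs Ω Z K q d A S) (n : ℕ)
    (φ : Model q → ℝ) : (fun ω => φ (model sch X n ω)) = fun ω =>
      ∑ w ∈ (finite_range_model sch X n).toFinset,
        (model sch X n ⁻¹' {w}).indicator (fun _ => φ w) ω := by
  funext ω
  rw [Finset.sum_eq_single (model sch X n ω)]
  · exact (Set.indicator_of_mem (Set.mem_singleton _) fun _ => φ (model sch X n ω)).symm
  · intro w _ hw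
    exact Set.indicator_of_notMem (fun h : model sch X n ω = w => hw h.symm) _
  · intro h
    exact absurd ((finite_range_model sch X n).mem_toFinset.2 ⟨ω, rfl⟩) h

variable {Ω Z : Type*} [MeasurableSpace Ω] [MeasurableSpace Z] {μ : Measure Ω}
  {K q d A S : ℕ} {sch : Scheme Z K q d A S} {X : Inputs Ω Z K q d A S}
  {σn : ℝ≥0} {D : Measure Z} {σ : Fin q → ℝ}

lemma measurableSet_model_eq' (hX : IsRayleighModel X σn μ)
    (hgrad : Measurable (fun p : Model q × Z => gradient (fun w => sch.loss w p.2) p.1)) (n : ℕ)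
    (w : Model q) : MeasurableSet (model sch X n ⁻¹' {w}) :=
  hX.sigmaOf_le _ _ (measurableSet_model_eq hgrad n w)

lemma measurable_decision (hX : IsRayleighModel X σn μ)
    (hgrad : Measurable (fun p : Model q × Z => gradient (fun w => sch.loss w p.2) p.1)) (n : ℕ)
    (i : Fin q) : Measurable fun ω => decision sch X n ω i := by
  have hPm : Measurable (power sch X n) :=
    (measurable_model_power hgrad n).2.mono (hX.sigmaOf_le _) le_rfl
  have hwm : Measurable (model sch X n) :=
    (measurable_model_power hgrad n).1.mono (hX.sigmaOf_le _) le_rfl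
  have hin : Measurable fun ω => ((power sch X n ω,
      (votes sch (model sch X n ω) fun m => X.batch n m ω), X.phase n ω),
        (fun m b => X.fading n m b ω), (fun b => X.noise n b ω)) :=
    (hPm.prodMk ((measurable_votes_model hgrad hwm (hX.measurable_batch n)).prodMk
      (hX.measurable_phase n))).prodMk
        ((measurable_pi_lambda _ fun m => measurable_pi_lambda _ fun b =>
          hX.measurable_fading n m b).prodMk (measurable_pi_lambda _ (hX.measurable_noise n)))
  have h := (measurable_detect sch i).comp hin
  exact h

variable [IsProbabilityMeasure μ]

/-- Mean decision of the detector at a fixed model and fixed powers of at least `1`. -/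
lemma mean_decision_margin (hX : IsRayleighModel X σn μ) (hK : 0 < K)
    (hgrad : Measurable (fun p : Model q × Z => gradient (fun w => sch.loss w p.2) p.1))
    (hE : 0 < sch.symbolEnergy) (hσn : 0 < σn) (hσ : ∀ i, 0 ≤ σ i)
    (hvar : UnbiasedBoundedVariance sch X μ D σ) (hnoise : UnimodalSymmetricNoise sch X μ)
    {w : Model q} (n : ℕ) {i : Fin q} (hg : gradient (globalLoss sch D) w i ≠ 0)
    {ϑ : ℝ} (hϑ : 0 < ϑ) (hϑ1 : ϑ ≤ 1) {P : Fin K → ℝ} (hP : ∀ m, 1 ≤ P m) :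
    1 / (1 + 2 / (sch.symbolEnergy * ϑ / (σn : ℝ) ^ 2 * K)) *
        (|gradient (globalLoss sch D) w i| - Real.sqrt 3 / 4 * (σ i / Real.sqrt d)) ≤
      gradient (globalLoss sch D) w i *
        ∫ ω, meanDecision sch.symbolEnergy σn P (votesAt sch X n i w ω) ∂μ := by
  have hmar := fun m => vote_margin hX hgrad hσ hvar hnoise (w := w) n m hg
  set g := gradient (globalLoss sch D) w i
  set c := Real.sqrt 3 / 4 * (σ i / Real.sqrt d)
  set E₀ := sch.symbolEnergy
  set den := E₀ * ∑ m, P m + 2 * (σn : ℝ) ^ 2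
  have hσr : (0 : ℝ) < σn := hσn
  have hKr : (0 : ℝ) < K := Nat.cast_pos.2 hK
  have hsum : (K : ℝ) * ϑ ≤ ∑ m, P m := by
    have h : ∑ _m : Fin K, (1 : ℝ) ≤ ∑ m, P m := Finset.sum_le_sum fun m _ => hP m
    simp at h
    nlinarith
  have hsum0 : 0 < ∑ m, P m := (mul_pos hKr hϑ).trans_le hsum
  have hden : 0 < den := by positivity
  have hVm : Measurable (votesAt sch X n i w) :=
    (measurable_votesAt sch (T := Set.univ) (fun m => trivial) hgrad i w).mono
      (hX.sigmaOf_le _) le_rfl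
  have hVi : ∀ m, Integrable (fun ω => votesAt sch X n i w ω m) μ := fun m =>
    Integrable.of_bound ((measurable_pi_apply m).comp hVm).aestronglyMeasurable 1
      (ae_of_all _ fun ω => abs_sign_le_one _)
  have hint : g * ∫ ω, meanDecision E₀ σn P (votesAt sch X n i w ω) ∂μ =
      ∑ m, E₀ * P m / den * (|g| * ∫ ω, Real.sign g * votesAt sch X n i w ω m ∂μ) := by
    have h1 : ∫ ω, meanDecision E₀ σn P (votesAt sch X n i w ω) ∂μ =
        ∫ ω, ∑ m, E₀ * P m / den * votesAt sch X n i w ω m ∂μ := by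
      refine integral_congr_ae ?_
      filter_upwards [ae_all_iff.2 fun m => (hmar m).1] with ω hω
      exact meanDecision_eq_sum hω
    rw [h1, integral_finsetSum _ fun m _ => (hVi m).const_mul _, Finset.mul_sum]
    refine Finset.sum_congr rfl fun m _ => ?_
    rw [integral_const_mul, integral_const_mul]
    have h2 : |g| * Real.sign g = g := by
      rcases hg.lt_or_gt with h | h
      · rw [Real.sign_of_neg h, abs_of_neg h]; ring
      · rw [Real.sign_of_pos h, abs_of_pos h]; ring
    linear_combination (-(E₀ * P m / den) * ∫ ω, votesAt sch X n i w ω m ∂μ) * h2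
  rw [hint]
  -- The total weight `E₀ x / (E₀ x + 2 σn²)` increases with the total power `x`; at `x = K ϑ` it
  -- equals the left side.
  have hκ : 1 / (1 + 2 / (E₀ * ϑ / (σn : ℝ) ^ 2 * K)) ≤ ∑ m, E₀ * P m / den := by
    have e1 : 1 / (1 + 2 / (E₀ * ϑ / (σn : ℝ) ^ 2 * K)) =
        E₀ * (K * ϑ) / (E₀ * (K * ϑ) + 2 * (σn : ℝ) ^ 2) := by
      field_simp
    have e2 : ∑ m, E₀ * P m / den = E₀ * ∑ m, P m / den := by
      rw [Finset.mul_sum]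
      exact Finset.sum_congr rfl fun m _ => by ring
    rw [e1, e2, ← Finset.sum_div, ← mul_div_assoc, div_le_div_iff₀ (by positivity) hden]
    have : E₀ * (K * ϑ) ≤ E₀ * ∑ m, P m := mul_le_mul_of_nonneg_left hsum hE.le
    have h2 : 0 ≤ 2 * (σn : ℝ) ^ 2 := by positivity
    simp only [den]
    nlinarith
  have hκ0 : 0 < 1 / (1 + 2 / (E₀ * ϑ / (σn : ℝ) ^ 2 * K)) := by positivity
  have hW : ∀ m, 0 ≤ E₀ * P m / den := fun m =>
    div_nonneg (mul_nonneg hE.le (zero_le_one.trans (hP m))) hden.le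
  -- The lower bound on the total weight helps only if the margin is positive. Otherwise the left
  -- side is nonpositive, and the nonnegative mean votes suffice.
  rcases le_or_gt (|g| - c) 0 with h | h
  · refine (mul_nonpos_of_nonneg_of_nonpos hκ0.le h).trans ?_
    exact Finset.sum_nonneg fun m _ => mul_nonneg (hW m) (mul_nonneg (abs_nonneg g) (hmar m).2.1)
  · calc _ ≤ (∑ m, E₀ * P m / den) * (|g| - c) := mul_le_mul_of_nonneg_right hκ h.le
      _ = ∑ m, E₀ * P m / den * (|g| - c) := Finset.sum_mul _ _ _
      _ ≤ _ := Finset.sum_le_sum fun m _ => mul_le_mul_of_nonneg_left (hmar m).2.2 (hW m)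

/-- Mean progress on one coordinate, on the event that the model of round `n` is `w`. -/
lemma setIntegral_progress (hX : IsRayleighModel X σn μ) (hK : 0 < K)
    (hgrad : Measurable (fun p : Model q × Z => gradient (fun w => sch.loss w p.2) p.1))
    (hE : 0 < sch.symbolEnergy) (hσn : 0 < σn) (hσ : ∀ i, 0 ≤ σ i)
    (hvar : UnbiasedBoundedVariance sch X μ D σ) (hnoise : UnimodalSymmetricNoise sch X μ)
    (w : Model q) {n : ℕ} {i : Fin q} (hdec : PowerVoteDecoupled sch X μ n i)
    {ϑ : ℝ} (hϑ : 0 < ϑ) (hϑ1 : ϑ ≤ 1) :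
    1 / (1 + 2 / (sch.symbolEnergy * ϑ / (σn : ℝ) ^ 2 * K)) *
        (|gradient (globalLoss sch D) w i| - Real.sqrt 3 / 4 * (σ i / Real.sqrt d)) *
        μ.real (model sch X n ⁻¹' {w}) ≤
      ∫ ω in model sch X n ⁻¹' {w},
        gradient (globalLoss sch D) w i * decision sch X n ω i ∂μ := by
  have hE' : MeasurableSet[X.past n] (model sch X n ⁻¹' {w}) := measurableSet_model_eq hgrad n w
  by_cases hg : gradient (globalLoss sch D) w i = 0
  · rw [hg]
    simp only [zero_mul, integral_zero, abs_zero, zero_sub]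
    have : 0 ≤ σ i := hσ i
    have h : 0 ≤ 1 / (1 + 2 / (sch.symbolEnergy * ϑ / (σn : ℝ) ^ 2 * K)) *
      (Real.sqrt 3 / 4 * (σ i / Real.sqrt d)) * μ.real (model sch X n ⁻¹' {w}) := by positivity
    linarith
  -- Clipping at `0` makes the integrand bounded for all arguments; it changes nothing at actual
  -- powers, which are at least `1`.
  let Φ : (Fin K → ℝ) × (Fin K → ℝ) → ℝ := fun p =>
    meanDecision sch.symbolEnergy σn (fun m => max (p.1 m) 0) p.2
  have hΦ : Measurable Φ := by
    have h : Measurable fun p : (Fin K → ℝ) × (Fin K → ℝ) =>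
        ((fun m => max (p.1 m) 0), p.2) := by fun_prop
    have h2 := (measurable_meanDecision (K := K) sch.symbolEnergy σn).comp h
    exact h2
  have hΦ1 : ∀ p, |Φ p| ≤ 1 := fun p =>
    abs_meanDecision_le_one hE hσn (fun m => le_max_right _ _) _
  have hPm : Measurable (power sch X n) :=
    (measurable_model_power hgrad n).2.mono (hX.sigmaOf_le _) le_rfl
  have hwm : Measurable (model sch X n) :=
    (measurable_model_power hgrad n).1.mono (hX.sigmaOf_le _) le_rfl
  have hVm : Measurable (votesAt sch X n i w) :=
    (measurable_votesAt sch (T := Set.univ) (fun m => trivial) hgrad i w).mono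
      (hX.sigmaOf_le _) le_rfl
  have hfac := setIntegral_comp_of_factorized (μ := μ) (E := model sch X n ⁻¹' {w}) hPm
    (measurable_coordVotes hgrad hwm (hX.measurable_batch n) i) hVm
    (fun B C hB hC => measure_power_votes_inter hX hgrad hdec w hB hC) hΦ hΦ1
  have hmax : ∀ ω, (fun m => max (power sch X n ω m) 0) = power sch X n ω := fun ω =>
    funext fun m => max_eq_left (zero_le_one.trans (one_le_power sch X n ω m))
  simp only [Φ, hmax] at hfac
  rw [integral_const_mul, setIntegral_decision hX hgrad hE hσn i hE', hfac, ← integral_const_mul]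
  have hin : Measurable fun p : (Fin K → ℝ) × Ω => Φ (p.1, votesAt sch X n i w p.2) :=
    hΦ.comp (measurable_fst.prodMk (hVm.comp measurable_snd))
  have hJ : StronglyMeasurable fun P : Fin K → ℝ => ∫ ω', Φ (P, votesAt sch X n i w ω') ∂μ :=
    hin.stronglyMeasurable.integral_prod_right'
  have hJb : ∀ P : Fin K → ℝ, |∫ ω', Φ (P, votesAt sch X n i w ω') ∂μ| ≤ 1 := fun P => by
    have := norm_integral_le_of_norm_le_const (μ := μ)
      (f := fun ω' => Φ (P, votesAt sch X n i w ω')) (C := 1) (ae_of_all _ fun ω => hΦ1 _)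
    simpa using this
  have hJi : Integrable (fun ω => ∫ ω', meanDecision sch.symbolEnergy σn (power sch X n ω)
      (votesAt sch X n i w ω') ∂μ) μ := by
    have h := Integrable.of_bound (μ := μ) (hJ.comp_measurable hPm).aestronglyMeasurable 1
      (ae_of_all _ fun ω => hJb _)
    simpa only [Φ, Function.comp_def, hmax] using h
  have hconst := setIntegral_const (μ := μ) (s := model sch X n ⁻¹' {w})
    (1 / (1 + 2 / (sch.symbolEnergy * ϑ / (σn : ℝ) ^ 2 * K)) *
        (|gradient (globalLoss sch D) w i| - Real.sqrt 3 / 4 * (σ i / Real.sqrt d)))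
  rw [smul_eq_mul] at hconst
  rw [mul_comm, ← hconst]
  refine setIntegral_mono (integrableOn_const (measure_ne_top _ _))
    (hJi.integrableOn.const_mul _) fun ω => ?_
  exact mean_decision_margin hX hK hgrad hE hσn hσ hvar hnoise n hg hϑ hϑ1
    (one_le_power sch X n ω)

lemma integrable_comp_model (hX : IsRayleighModel X σn μ)
    (hgrad : Measurable (fun p : Model q × Z => gradient (fun w => sch.loss w p.2) p.1)) (n : ℕ)
    (φ : Model q → ℝ) : Integrable (fun ω => φ (model sch X n ω)) μ := by
  rw [comp_model_eq_sum]
  exact integrable_finsetSum _ fun w _ =>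
    (integrable_const _).indicator (measurableSet_model_eq' hX hgrad n w)

lemma integral_comp_model (hX : IsRayleighModel X σn μ)
    (hgrad : Measurable (fun p : Model q × Z => gradient (fun w => sch.loss w p.2) p.1)) (n : ℕ)
    (φ : Model q → ℝ) : ∫ ω, φ (model sch X n ω) ∂μ =
      ∑ w ∈ (finite_range_model sch X n).toFinset, φ w * μ.real (model sch X n ⁻¹' {w}) := by
  rw [comp_model_eq_sum, integral_finsetSum _ fun w _ =>
    (integrable_const _).indicator (measurableSet_model_eq' hX hgrad n w)]
  refine Finset.sum_congr rfl fun w _ => ?_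
  rw [integral_indicator_const _ (measurableSet_model_eq' hX hgrad n w), smul_eq_mul, mul_comm]

lemma integrable_mul_decision (hX : IsRayleighModel X σn μ)
    (hgrad : Measurable (fun p : Model q × Z => gradient (fun w => sch.loss w p.2) p.1)) (n : ℕ)
    (φ : Model q → ℝ) (i : Fin q) :
    Integrable (fun ω => φ (model sch X n ω) * decision sch X n ω i) μ :=
  (integrable_comp_model hX hgrad n φ).mul_bdd (c := 1)
    (measurable_decision hX hgrad n i).aestronglyMeasurable (ae_of_all _ fun _ => abs_sign_le_one _)

/-- Mean progress of one round on one coordinate. -/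
lemma integral_progress (hX : IsRayleighModel X σn μ) (hK : 0 < K)
    (hgrad : Measurable (fun p : Model q × Z => gradient (fun w => sch.loss w p.2) p.1))
    (hE : 0 < sch.symbolEnergy) (hσn : 0 < σn) (hσ : ∀ i, 0 ≤ σ i)
    (hvar : UnbiasedBoundedVariance sch X μ D σ) (hnoise : UnimodalSymmetricNoise sch X μ)
    {n : ℕ} {i : Fin q} (hdec : PowerVoteDecoupled sch X μ n i)
    {ϑ : ℝ} (hϑ : 0 < ϑ) (hϑ1 : ϑ ≤ 1) :
    1 / (1 + 2 / (sch.symbolEnergy * ϑ / (σn : ℝ) ^ 2 * K)) *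
        (∫ ω, |gradient (globalLoss sch D) (model sch X n ω) i| ∂μ -
          Real.sqrt 3 / 4 * (σ i / Real.sqrt d)) ≤
      ∫ ω, gradient (globalLoss sch D) (model sch X n ω) i * decision sch X n ω i ∂μ := by
  have hm := measurableSet_model_eq' (n := n) hX hgrad
  have h1 : ∫ ω, |gradient (globalLoss sch D) (model sch X n ω) i| ∂μ -
      Real.sqrt 3 / 4 * (σ i / Real.sqrt d) =
      ∑ w ∈ (finite_range_model sch X n).toFinset,
        (|gradient (globalLoss sch D) w i| - Real.sqrt 3 / 4 * (σ i / Real.sqrt d)) *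
          μ.real (model sch X n ⁻¹' {w}) := by
    rw [← integral_comp_model hX hgrad n (fun w => |gradient (globalLoss sch D) w i| -
      Real.sqrt 3 / 4 * (σ i / Real.sqrt d)), integral_sub (integrable_comp_model hX hgrad n
      fun w => |gradient (globalLoss sch D) w i|) (integrable_const _)]
    simp
  have h2 : ∫ ω, gradient (globalLoss sch D) (model sch X n ω) i * decision sch X n ω i ∂μ =
      ∑ w ∈ (finite_range_model sch X n).toFinset, ∫ ω in model sch X n ⁻¹' {w},
        gradient (globalLoss sch D) w i * decision sch X n ω i ∂μ := by
    have e : ∀ ω, gradient (globalLoss sch D) (model sch X n ω) i * decision sch X n ω i =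
        ∑ w ∈ (finite_range_model sch X n).toFinset, (model sch X n ⁻¹' {w}).indicator
          (fun ω => gradient (globalLoss sch D) w i * decision sch X n ω i) ω := fun ω => by
      have := congrFun (comp_model_eq_sum sch X n fun w => gradient (globalLoss sch D) w i) ω
      simp only at this
      rw [this, Finset.sum_mul]
      refine Finset.sum_congr rfl fun w _ => ?_
      simp only [Set.indicator]
      split_ifs <;> simp
    simp_rw [e]
    have hdi : ∀ w, Integrable (fun ω => gradient (globalLoss sch D) w i * decision sch X n ω i) μ :=
      fun w => integrable_mul_decision hX hgrad n (fun _ => gradient (globalLoss sch D) w i) i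
    rw [integral_finsetSum _ fun w _ => (hdi w).indicator (hm w)]
    exact Finset.sum_congr rfl fun w _ => integral_indicator (hm w)
  rw [h1, h2, Finset.mul_sum]
  refine Finset.sum_le_sum fun w _ => ?_
  rw [← mul_assoc]
  exact setIntegral_progress hX hK hgrad hE hσn hσ hvar hnoise w hdec hϑ hϑ1

/-- Expected decrease of the global loss in one round. -/
lemma integral_loss_succ_le (hX : IsRayleighModel X σn μ) (hK : 0 < K)
    (hgrad : Measurable (fun p : Model q × Z => gradient (fun w => sch.loss w p.2) p.1))
    (hE : 0 < sch.symbolEnergy) (hσn : 0 < σn) (hσ : ∀ i, 0 ≤ σ i) {L : Fin q → ℝ}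
    (hL : ∀ i, 0 ≤ L i) (hsmooth : IsSmooth (globalLoss sch D) L)
    (hvar : UnbiasedBoundedVariance sch X μ D σ) (hnoise : UnimodalSymmetricNoise sch X μ)
    {n : ℕ} (hdec : ∀ i, PowerVoteDecoupled sch X μ n i)
    {ϑ : ℝ} (hϑ : 0 < ϑ) (hϑ1 : ϑ ≤ 1) (hη : 0 ≤ sch.stepSize) :
    ∫ ω, globalLoss sch D (model sch X (n + 1) ω) ∂μ ≤
      ∫ ω, globalLoss sch D (model sch X n ω) ∂μ -
        sch.stepSize * (1 / (1 + 2 / (sch.symbolEnergy * ϑ / (σn : ℝ) ^ 2 * K)) *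
          (∫ ω, gradL1 sch X D n ω ∂μ - Real.sqrt 3 / 4 * (l1 σ / Real.sqrt d))) +
        1 / 2 * (sch.stepSize ^ 2 * l1 L) := by
  set F := globalLoss sch D
  set η := sch.stepSize
  have hpt : ∀ ω, F (model sch X (n + 1) ω) ≤ F (model sch X n ω) -
      η * ∑ i, gradient F (model sch X n ω) i * decision sch X n ω i +
      1 / 2 * (η ^ 2 * l1 L) := fun ω => by
    have h := (abs_le.1 (hsmooth.2 (model sch X n ω) (model sch X (n + 1) ω))).2
    have hdiff : ∀ i, model sch X (n + 1) ω i - model sch X n ω i = -η * decision sch X n ω i :=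
      fun i => by
        rw [model_succ]
        simp [decision, η]
    simp only [hdiff] at h
    have h1 : ∑ i, gradient F (model sch X n ω) i * (-η * decision sch X n ω i) =
        -(η * ∑ i, gradient F (model sch X n ω) i * decision sch X n ω i) := by
      rw [Finset.mul_sum, ← Finset.sum_neg_distrib]
      exact Finset.sum_congr rfl fun i _ => by ring
    -- A decision may be `0` on a tie, so its square is only bounded by `1`.
    have h2 : ∑ i, L i * (-η * decision sch X n ω i) ^ 2 ≤ η ^ 2 * l1 L := by
      rw [l1, Finset.mul_sum]
      refine Finset.sum_le_sum fun i _ => ?_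
      have h3 : decision sch X n ω i ^ 2 ≤ 1 := (sq_le_one_iff_abs_le_one _).2 (abs_sign_le_one _)
      rw [abs_of_nonneg (hL i)]
      have h4 : 0 ≤ L i * η ^ 2 := mul_nonneg (hL i) (sq_nonneg _)
      nlinarith
    rw [h1] at h
    linarith
  have hgi : ∀ i, Integrable (fun ω => gradient F (model sch X n ω) i * decision sch X n ω i) μ :=
    fun i => integrable_mul_decision hX hgrad n (fun w => gradient F w i) i
  have hFi : ∀ n, Integrable (fun ω => F (model sch X n ω)) μ := fun n =>
    integrable_comp_model hX hgrad n F
  have hsi : Integrable (fun ω => η * ∑ i, gradient F (model sch X n ω) i * decision sch X n ω i) μ :=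
    (integrable_finsetSum _ fun i _ => hgi i).const_mul _
  have hFs : Integrable (fun ω => F (model sch X n ω) -
      η * ∑ i, gradient F (model sch X n ω) i * decision sch X n ω i) μ := (hFi n).sub hsi
  have hmono := integral_mono (hFi (n + 1)) (hFs.add (integrable_const _)) hpt
  have hval : ∫ ω, (F (model sch X n ω) -
      η * ∑ i, gradient F (model sch X n ω) i * decision sch X n ω i +
      1 / 2 * (η ^ 2 * l1 L)) ∂μ = ∫ ω, F (model sch X n ω) ∂μ -
      η * ∑ i, ∫ ω, gradient F (model sch X n ω) i * decision sch X n ω i ∂μ +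
      1 / 2 * (η ^ 2 * l1 L) := by
    rw [integral_add hFs (integrable_const _), integral_sub (hFi n) hsi,
      integral_const_mul, integral_finsetSum _ fun i _ => hgi i]
    simp
  refine hmono.trans (hval.trans_le ?_)
  have hsum := Finset.sum_le_sum fun (i : Fin q) (_ : i ∈ Finset.univ) =>
    integral_progress hX hK hgrad hE hσn hσ hvar hnoise (hdec i) hϑ hϑ1
  rw [← Finset.mul_sum, Finset.sum_sub_distrib, ← Finset.mul_sum, ← Finset.sum_div,
    ← integral_finsetSum _ fun i _ => integrable_comp_model hX hgrad n
      fun w => |gradient F w i|] at hsum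
  have hl1 : l1 σ = ∑ i, σ i := Finset.sum_congr rfl fun i _ => abs_of_nonneg (hσ i)
  rw [hl1]
  have := mul_le_mul_of_nonneg_left hsum hη
  simp only [gradL1, l1]
  linarith

end Descent

/-- Rate obtained by summing the one-round decreases with the prescribed step size. -/
lemma rate_of_descent {N γ d : ℕ} (hd : 0 < d) (hγ : 0 < γ) (hN : (d : ℝ) = N / γ)
    {G Δ ℓ s T : ℝ} (hℓ : 0 < ℓ) (hs : 0 ≤ s) (hT : 0 < T)
    (h : 1 / Real.sqrt (ℓ * d) * (1 / T * (G - N * (Real.sqrt 3 / 4 * (s / Real.sqrt d)))) ≤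
      Δ + N * (1 / 2 * ((1 / Real.sqrt (ℓ * d)) ^ 2 * ℓ))) :
    1 / N * G ≤ 1 / Real.sqrt N * (T * (1 / Real.sqrt γ) * Real.sqrt ℓ * (Δ + γ / 2) +
      2 * Real.sqrt 2 / 6 * Real.sqrt γ * s) := by
  have hd' : (0 : ℝ) < d := Nat.cast_pos.2 hd
  have hγ' : (0 : ℝ) < γ := Nat.cast_pos.2 hγ
  have hNd : (N : ℝ) = d * γ := by rw [hN]; field_simp
  have hN' : (0 : ℝ) < N := by rw [hNd]; positivity
  -- Squared, this is `3/16 ≤ 2/9`; only here is the Gauss-type constant weakened.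
  have h3 : Real.sqrt 3 / 4 ≤ 2 * Real.sqrt 2 / 6 := by
    apply le_of_sq_le_sq _ (by positivity)
    rw [div_pow, div_pow, mul_pow, Real.sq_sqrt (by norm_num), Real.sq_sqrt (by norm_num)]
    norm_num
  rw [div_pow, one_pow, Real.sq_sqrt (by positivity)] at h
  rw [hNd] at h ⊢
  rw [Real.sqrt_mul hℓ.le] at h
  rw [Real.sqrt_mul hd'.le]
  set a := Real.sqrt d
  set b := Real.sqrt γ
  set l := Real.sqrt ℓ
  have ha : 0 < a := Real.sqrt_pos.2 hd'
  have hb : 0 < b := Real.sqrt_pos.2 hγ'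
  have hl : 0 < l := Real.sqrt_pos.2 hℓ
  have ha2 : (d : ℝ) = a ^ 2 := (Real.sq_sqrt hd'.le).symm
  have hb2 : (γ : ℝ) = b ^ 2 := (Real.sq_sqrt hγ'.le).symm
  have hl2 : ℓ = l ^ 2 := (Real.sq_sqrt hℓ.le).symm
  rw [ha2, hb2, hl2] at h
  rw [ha2, hb2]
  -- Since `η² ‖L‖₁ = 1 / d` and `N = d γ`, the quadratic terms of all rounds add up to `γ / 2`.
  have e1 : a ^ 2 * b ^ 2 * (1 / 2 * (1 / (l ^ 2 * a ^ 2) * l ^ 2)) = b ^ 2 / 2 := by field_simp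
  rw [e1] at h
  have e2 : 1 / (l * a) * (1 / T * (G - a ^ 2 * b ^ 2 * (Real.sqrt 3 / 4 * (s / a)))) =
      (G - a * b ^ 2 * (Real.sqrt 3 / 4 * s)) / (l * a * T) := by field_simp
  rw [e2, div_le_iff₀ (by positivity)] at h
  have e3 : 1 / (a * b) * (T * (1 / b) * l * (Δ + b ^ 2 / 2) + 2 * Real.sqrt 2 / 6 * b * s) =
      1 / (a ^ 2 * b ^ 2) * ((Δ + b ^ 2 / 2) * (l * a * T) +
        a * b ^ 2 * (2 * Real.sqrt 2 / 6 * s)) := by field_simp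
  rw [e3]
  refine mul_le_mul_of_nonneg_left ?_ (by positivity)
  have h4 : a * b ^ 2 * (Real.sqrt 3 / 4 * s) ≤ a * b ^ 2 * (2 * Real.sqrt 2 / 6 * s) := by gcongr
  linarith

end FSKMV

theorem theorem3p4 {Ω Z : Type*} [MeasurableSpace Ω] [MeasurableSpace Z]
    (μ : Measure Ω) [IsProbabilityMeasure μ] (D : Measure Z) [IsProbabilityMeasure D]
    {K q d A S : ℕ} (sch : FSKMV.Scheme Z K q d A S) (X : FSKMV.Inputs Ω Z K q d A S)
    (N γ : ℕ) (L σ : Fin q → ℝ) (σn : ℝ≥0) (ϑ Fstar β τ : ℝ)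
    (hK : 0 < K) (hd : 0 < d) (hγ : 0 < γ) (hE : 0 < sch.symbolEnergy) (hσn : 0 < σn)
    (hL : ∀ i, 0 ≤ L i) (hLpos : 0 < FSKMV.l1 L) (hσ : ∀ i, 0 ≤ σ i)
    -- the sample-wise loss
    (hdiff : ∀ z, Differentiable ℝ (fun w => sch.loss w z))
    (hgrad : Measurable (fun p : FSKMV.Model q × Z => gradient (fun w => sch.loss w p.2) p.1))
    (hint : ∀ w, Integrable (sch.loss w) D)
    -- fading channel, noise and fresh independent batches
    (hX : FSKMV.IsRayleighModel X σn μ)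
    -- bounded loss, smoothness, variance bound, unimodal symmetric noise
    (hF : ∀ w, Fstar ≤ FSKMV.globalLoss sch D w)
    (hsmooth : FSKMV.IsSmooth (FSKMV.globalLoss sch D) L)
    (hvar : FSKMV.UnbiasedBoundedVariance sch X μ D σ)
    (hnoise : FSKMV.UnimodalSymmetricNoise sch X μ)
    -- transmit power
    (hdec : ∀ n < N, ∀ i, FSKMV.PowerVoteDecoupled sch X μ n i)
    (hϑ : 0 < ϑ) (havg : ∀ n < N, ϑ ≤ FSKMV.avgPower sch X μ n)
    -- batch size, learning rate and constants
    (hN : (d : ℝ) = N / γ) (hη : sch.stepSize = 1 / Real.sqrt (FSKMV.l1 L * d))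
    (hβ : β = sch.symbolEnergy * ϑ / (σn : ℝ) ^ 2)
    (hτ : τ = (1 + 2 / (β * K)) * (1 / Real.sqrt γ)) :
    (∀ n < N, Integrable (FSKMV.gradL1 sch X D n) μ) ∧
    ∫ ω, (1 / (N : ℝ)) * ∑ n ∈ Finset.range N, FSKMV.gradL1 sch X D n ω ∂μ
      ≤ (1 / Real.sqrt N) *
        (τ * Real.sqrt (FSKMV.l1 L) * (FSKMV.globalLoss sch D sch.init - Fstar + γ / 2)
          + (2 * Real.sqrt 2 / 6) * Real.sqrt γ * FSKMV.l1 σ) := by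
  have hgi : ∀ n, Integrable (FSKMV.gradL1 sch X D n) μ := fun n =>
    FSKMV.integrable_comp_model hX hgrad n
      fun w => FSKMV.l1 fun i => gradient (FSKMV.globalLoss sch D) w i
  refine ⟨fun n _ => hgi n, ?_⟩
  have hKr : (0 : ℝ) < K := Nat.cast_pos.2 hK
  have hd' : (0 : ℝ) < d := Nat.cast_pos.2 hd
  have hN0 : 0 < N := by
    rcases Nat.eq_zero_or_pos N with h | h
    · rw [h, Nat.cast_zero, zero_div] at hN
      exact absurd hN hd'.ne'
    · exact h
  -- Every power is `1` in round `0`, which occurs because `d > 0` forces `N > 0`; so the average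
  -- power there is exactly `1`.
  have hϑ1 : ϑ ≤ 1 := by
    refine (havg 0 hN0).trans_eq ?_
    simp [FSKMV.avgPower, FSKMV.power, FSKMV.state, hKr.ne']
  have hη0 : 0 ≤ sch.stepSize := by rw [hη]; positivity
  have hdescent : ∀ n ≤ N, ∫ ω, FSKMV.globalLoss sch D (FSKMV.model sch X n ω) ∂μ ≤
      FSKMV.globalLoss sch D sch.init - sch.stepSize * (1 / (1 + 2 / (β * K)) *
        (∑ k ∈ Finset.range n, ∫ ω, FSKMV.gradL1 sch X D k ω ∂μ -
          n * (Real.sqrt 3 / 4 * (FSKMV.l1 σ / Real.sqrt d)))) +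
        n * (1 / 2 * (sch.stepSize ^ 2 * FSKMV.l1 L)) := by
    intro n
    induction n with
    | zero => intro _; simp [FSKMV.model, FSKMV.state]
    | succ n ih =>
      intro hn
      have h := FSKMV.integral_loss_succ_le hX hK hgrad hE hσn hσ hL hsmooth hvar hnoise
        (hdec n hn) hϑ hϑ1 hη0
      rw [← hβ] at h
      rw [Finset.sum_range_succ]
      push_cast
      linarith [ih (Nat.le_of_succ_le hn)]
  have hlow : Fstar ≤ ∫ ω, FSKMV.globalLoss sch D (FSKMV.model sch X N ω) ∂μ := by
    have h := integral_mono (integrable_const Fstar) (FSKMV.integrable_comp_model hX hgrad N _)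
      fun ω => hF (FSKMV.model sch X N ω)
    simpa using h
  have hβ0 : 0 < β := by
    have h : (0 : ℝ) < σn := hσn
    rw [hβ]
    positivity
  rw [integral_const_mul, integral_finsetSum _ fun n _ => hgi n, hτ]
  refine FSKMV.rate_of_descent hd hγ hN hLpos (Finset.sum_nonneg fun i _ => abs_nonneg _)
    (by positivity) ?_
  rw [← hη]
  linarith [hdescent N le_rfl]
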